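/- Let $\mathfrak g=\mathfrak g_{\bar 0}\oplus\mathfrak g_{\bar 1}$ be a Lie superalgebra over $\mathbb C$ with $\dim\mathfrak g_{\bar 1}<\infty$ ($\mathfrak g_{\bar 0}$ may be infinite-dimensional), with a compatible $\mathbb Z$-grading $\mathfrak g=\mathfrak g_{-1}\oplus\mathfrak g_0\oplus\mathfrak g_1$: that is, $\mathfrak g_0=\mathfrak g_{\bar 0}$, $\mathfrak g_{\bar 1}=\mathfrak g_{-1}\oplus\mathfrak g_1$, the spaces $\mathfrak g_{\pm1}$ are $\mathfrak g_0$-submodules of $\mathfrak g_{\bar 1}$, and $[\mathfrak g_1,\mathfrak g_1]=[\mathfrak g_{-1},\mathfrak g_{-1}]=0$. Put $\mathfrak g_{\ge 0}=\mathfrak g_0\oplus\mathfrak g_1$ and $\mathfrak g_{\le 0}=\mathfrak g_0\oplus\mathfrak g_{-1}$, and let $U(\cdot)$ denote the universal enveloping superalgebra. Extend a $\mathfrak g_0$-supermodule $N$ to a $\mathfrak g_{\ge 0}$-supermodule (resp. to a $\mathfrak g_{\le 0}$-supermodule) by letting $\mathfrak g_1$ (resp. $\mathfrak g_{-1}$)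 act by zero, and, for $\mathfrak p=\mathfrak g_{\ge 0}$ (resp. $\mathfrak p=\mathfrak g_{\le 0}$), let $$\mathrm{Ind}_{\mathfrak p}^{\mathfrak g}(N)=U(\mathfrak g)\otimes_{U(\mathfrak p)}N,$$ and let $\mathrm{Coind}_{\mathfrak p}^{\mathfrak g}(N)$ be the span of the homogeneous $f\in\mathrm{Hom}_{\mathbb C}(U(\mathfrak g),N)$ such that $f(pu)=(-1)^{\bar p\bar f}p f(u)$ for all homogeneous $p\in\mathfrak p$ and all $u\in U(\mathfrak g)$, with the action $(xf)(u)=(-1)^{\bar x(\bar u+\bar f)}f(ux)$ for homogeneous $x\in\mathfrak g$, $f$ and $u\in U(\mathfrak g)$. Let $K(N)=\mathrm{Ind}_{\mathfrak g_{\ge 0}}^{\mathfrak g}(N)$ be the Kac module and $K'(N)=\mathrm{Ind}_{\mathfrak g_{\le 0}}^{\mathfrak g}(N)$ the opposite Kac module. For a $\mathfrak g_0$-module $W$ of finite dimension $d$, let $\Lambda^{\max}(W)=\Lambda^{d}(W)$ with the induced $\mathfrak g_0$-action; for $W=\mathfrak g_{\pm1}$ and $W=\mathfrak g_{\pm1}^*$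 it is a $\mathfrak g_0$-supermodule concentrated in parity $d \bmod 2$. Then for every simple $\mathfrak g_0$-supermodule $V$ there are isomorphisms of $\mathfrak g$-supermodules, up to parity change, $$\mathrm{Coind}_{\mathfrak g_{\ge 0}}^{\mathfrak g}(\Lambda^{\max}(\mathfrak g_{-1})\otimes V)\cong K(V),\qquad \mathrm{Coind}_{\mathfrak g_{\ge 0}}^{\mathfrak g}(V)\cong K(\Lambda^{\max}(\mathfrak g_{-1}^*)\otimes V),$$ $$\mathrm{Coind}_{\mathfrak g_{\le 0}}^{\mathfrak g}(\Lambda^{\max}(\mathfrak g_{1})\otimes V)\cong K'(V),\qquad \mathrm{Coind}_{\mathfrak g_{\le 0}}^{\mathfrak g}(V)\cong K'(\Lambda^{\max}(\mathfrak g_{1}^*)\otimes V).$$ Here "$M\cong N$ up to parity change" means that $M$ is isomorphic, by an isomorphism homogeneous of degree zero, to $N$ or to its parity shift $\Pi N$. -/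

import Mathlib

open scoped TensorProduct

noncomputable section

universe u v w

/-- The sign `(-1)^i` of a parity `i`; the Koszul sign of parities `i`, `j` is `sgn (i * j)`. -/
def sgn (i : ZMod 2) : ℂ := if i = 0 then 1 else -1

@[simp] theorem sgn_zero : sgn 0 = 1 := by simp [sgn]

@[simp] theorem sgn_one : sgn 1 = -1 := by simp [sgn]

theorem zmod_two_cases (i : ZMod 2) : i = 0 ∨ i = 1 := by
  revert i; decide

theorem sgn_add (i j : ZMod 2) : sgn (i + j) = sgn i * sgn j := by
  have h : (1 : ZMod 2) + 1 = 0 := by decide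
  rcases zmod_two_cases i with rfl | rfl <;> rcases zmod_two_cases j with rfl | rfl <;> simp [h]

theorem sgn_mul_self (i : ZMod 2) : sgn i * sgn i = 1 := by
  rcases zmod_two_cases i with rfl | rfl <;> simp

/-! ### Superspaces -/

/-- A structure of complex vector superspace on `M`: a decomposition `M = M₀ ⊕ M₁`. -/
structure Superspace (M : Type v) [AddCommGroup M] [Module ℂ M] where
  part : ZMod 2 → Submodule ℂ M
  isCompl : IsCompl (part 0) (part 1)

namespace Superspace

variable {M : Type v} [AddCommGroup M] [Module ℂ M]
  {N : Type w} [AddCommGroup N] [Module ℂ N]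

theorem isCompl_add_one (S : Superspace M) (i : ZMod 2) :
    IsCompl (S.part i) (S.part (i + 1)) := by
  rcases zmod_two_cases i with rfl | rfl
  · simpa using S.isCompl
  · have h : (1 : ZMod 2) + 1 = 0 := by decide
    rw [h]; exact S.isCompl.symm

/-- The projection of `M` onto its homogeneous component of parity `i`. -/
def proj (S : Superspace M) (i : ZMod 2) : M →ₗ[ℂ] M :=
  (S.part i).projection (S.part (i + 1)) (S.isCompl_add_one i)

theorem proj_mem (S : Superspace M) (i : ZMod 2) (m : M) : S.proj i m ∈ S.part i :=
  Submodule.projection_apply_mem _ m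

theorem proj_of_mem (S : Superspace M) {i : ZMod 2} {m : M} (h : m ∈ S.part i) :
    S.proj i m = m :=
  (Submodule.projection_eq_self_iff (S.isCompl_add_one i) m).2 h

theorem proj_add_one_of_mem (S : Superspace M) {i : ZMod 2} {m : M} (h : m ∈ S.part i) :
    S.proj (i + 1) m = 0 := by
  refine (Submodule.projection_apply_eq_zero_iff (S.isCompl_add_one (i + 1))).2 ?_
  have h2 : i + 1 + 1 = i := (by decide : ∀ i : ZMod 2, i + 1 + 1 = i) i
  rwa [h2]

theorem proj_add_proj (S : Superspace M) (m : M) : S.proj 0 m + S.proj 1 m = m := by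
  have h0 := Submodule.mem_sup.1 (S.isCompl.sup_eq_top ▸ Submodule.mem_top (x := m))
  obtain ⟨a, ha, b, hb, rfl⟩ := h0
  have h1 : (0 : ZMod 2) + 1 = 1 := by decide
  have h2 : (1 : ZMod 2) + 1 = 0 := by decide
  have e1 := S.proj_add_one_of_mem ha
  have e2 := S.proj_add_one_of_mem hb
  rw [h1] at e1
  rw [h2] at e2
  simp [S.proj_of_mem ha, S.proj_of_mem hb, e1, e2]

/-- The parity involution `m ↦ (-1)^i m` for `m` homogeneous of parity `i`. -/
def inv (S : Superspace M) : M →ₗ[ℂ] M := S.proj 0 - S.proj 1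

theorem inv_of_mem (S : Superspace M) {i : ZMod 2} {m : M} (h : m ∈ S.part i) :
    S.inv m = sgn i • m := by
  have h1 : (0 : ZMod 2) + 1 = 1 := by decide
  have h2 : (1 : ZMod 2) + 1 = 0 := by decide
  have e1 := S.proj_add_one_of_mem h
  have e2 := S.proj_of_mem h
  rcases zmod_two_cases i with rfl | rfl
  · rw [h1] at e1; simp [inv, e1, e2]
  · rw [h2] at e1; simp [inv, e1, e2]

theorem induction (S : Superspace M) {P : M → Prop} (hadd : ∀ a b, P a → P b → P (a + b))
    (h : ∀ i, ∀ m ∈ S.part i, P m) (m : M) : P m := by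
  rw [← S.proj_add_proj m]
  exact hadd _ _ (h 0 _ (S.proj_mem 0 m)) (h 1 _ (S.proj_mem 1 m))

theorem inv_inv (S : Superspace M) (m : M) : S.inv (S.inv m) = m := by
  induction m using S.induction with
  | hadd a b ha hb => simp [ha, hb]
  | h i m hm => rw [S.inv_of_mem hm, map_smul, S.inv_of_mem hm, smul_smul, sgn_mul_self, one_smul]

/-- Two submodules spanning `M` on which a linear map acts by `1` and `-1` form a superspace. -/
theorem isCompl_of_inv (part : ZMod 2 → Submodule ℂ M) (σ : M →ₗ[ℂ] M)
    (hσ : ∀ i, ∀ m ∈ part i, σ m = sgn i • m)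
    (htop : ∀ m, ∃ a ∈ part 0, ∃ b ∈ part 1, a + b = m) : IsCompl (part 0) (part 1) := by
  constructor
  · rw [Submodule.disjoint_def]
    intro m h0 h1
    have e0 := hσ 0 m h0
    have e1 := hσ 1 m h1
    rw [e0] at e1
    simp only [sgn_zero, sgn_one, one_smul, neg_smul] at e1
    have : (2 : ℂ) • m = 0 := by
      rw [two_smul]; nth_rewrite 1 [e1]; simp
    simpa using this
  · rw [codisjoint_iff, eq_top_iff]
    intro m _
    exact Submodule.mem_sup.2 (htop m)

/-- The eigenspace of `σ` for the eigenvalue `(-1)^i`. -/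
def invPart (σ : M →ₗ[ℂ] M) (i : ZMod 2) : Submodule ℂ M where
  carrier := {m | σ m = sgn i • m}
  add_mem' := fun {a b} ha hb => by
    simp only [Set.mem_ofPred_eq] at ha hb ⊢
    rw [map_add, ha, hb, smul_add]
  zero_mem' := by simp
  smul_mem' := fun c a ha => by
    simp only [Set.mem_ofPred_eq] at ha ⊢
    rw [map_smul, ha, smul_comm]

/-- The superspace given by the eigenspaces of an involution. -/
def ofInv (σ : M →ₗ[ℂ] M) (hσ : ∀ m, σ (σ m) = m) : Superspace M where
  part := invPart σ
  isCompl := by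
    refine isCompl_of_inv _ σ (fun i m hm => hm) fun m => ?_
    refine ⟨(2⁻¹ : ℂ) • (m + σ m), ?_, (2⁻¹ : ℂ) • (m - σ m), ?_, ?_⟩
    · change σ _ = _
      simp [hσ, add_comm]
    · change σ _ = _
      simp only [map_smul, map_sub, hσ, sgn_one, neg_smul, one_smul, ← smul_neg, neg_sub]
    · rw [← smul_add]
      have : m + σ m + (m - σ m) = (2 : ℂ) • m := by rw [two_smul]; abel
      rw [this, smul_smul]; norm_num

theorem mem_ofInv {σ : M →ₗ[ℂ] M} {hσ : ∀ m, σ (σ m) = m} {i : ZMod 2} {m : M} :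
    m ∈ (ofInv σ hσ).part i ↔ σ m = sgn i • m := Iff.rfl

/-- The parity shift `Π M`: `(Π M)₀ = M₁`, `(Π M)₁ = M₀`. -/
def shift (S : Superspace M) : Superspace M where
  part i := S.part (i + 1)
  isCompl := by
    have h : (1 : ZMod 2) + 1 = 0 := by decide
    rw [h, zero_add]; exact S.isCompl.symm

/-- `M` concentrated in the single parity `d`. -/
def pure (M : Type v) [AddCommGroup M] [Module ℂ M] (d : ZMod 2) : Superspace M where
  part i := if i = d then ⊤ else ⊥
  isCompl := by
    rcases zmod_two_cases d with rfl | rfl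
    · simpa using isCompl_top_bot
    · simpa using isCompl_bot_top

/-- The homogeneous component `(M ⊗ N)_k = ∑_{i + j = k} M_i ⊗ N_j`. -/
def tensorPart (S : Superspace M) (T : Superspace N) (k : ZMod 2) : Submodule ℂ (M ⊗[ℂ] N) :=
  Submodule.span ℂ {t | ∃ i j, i + j = k ∧ ∃ a ∈ S.part i, ∃ b ∈ T.part j, t = a ⊗ₜ[ℂ] b}

theorem tmul_mem_tensorPart {S : Superspace M} {T : Superspace N} {i j k : ZMod 2} {a : M} {b : N}
    (ha : a ∈ S.part i) (hb : b ∈ T.part j) (hk : i + j = k) :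
    a ⊗ₜ[ℂ] b ∈ tensorPart S T k :=
  Submodule.subset_span ⟨i, j, hk, a, ha, b, hb, rfl⟩

theorem inv_tensorPart {S : Superspace M} {T : Superspace N} (k : ZMod 2) (t : M ⊗[ℂ] N)
    (ht : t ∈ tensorPart S T k) : TensorProduct.map S.inv T.inv t = sgn k • t := by
  induction ht using Submodule.span_induction with
  | mem t h =>
    obtain ⟨i, j, rfl, a, ha, b, hb, rfl⟩ := h
    rw [TensorProduct.map_tmul, S.inv_of_mem ha, T.inv_of_mem hb, TensorProduct.smul_tmul_smul,
      sgn_add]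
  | zero => simp
  | add a b _ _ ha hb => simp [ha, hb]
  | smul c a _ ha => rw [map_smul, ha, smul_comm]

theorem tensorPart_decomp (S : Superspace M) (T : Superspace N) (t : M ⊗[ℂ] N) :
    ∃ a ∈ tensorPart S T 0, ∃ b ∈ tensorPart S T 1, a + b = t := by
  rw [← Submodule.mem_sup]
  have key : ∀ k, tensorPart S T k ≤ tensorPart S T 0 ⊔ tensorPart S T 1 := by
    intro k
    rcases zmod_two_cases k with rfl | rfl
    · exact le_sup_left
    · exact le_sup_right
  induction t using TensorProduct.induction_on with
  | zero => exact Submodule.zero_mem _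
  | add a b ha hb => exact Submodule.add_mem _ ha hb
  | tmul a b =>
    induction a using S.induction with
    | hadd a a' ha ha' => rw [TensorProduct.add_tmul]; exact Submodule.add_mem _ ha ha'
    | h i a ha =>
      induction b using T.induction with
      | hadd b b' hb hb' => rw [TensorProduct.tmul_add]; exact Submodule.add_mem _ hb hb'
      | h j b hb => exact key _ (tmul_mem_tensorPart ha hb rfl)

/-- The tensor product of superspaces. -/
def tensor (S : Superspace M) (T : Superspace N) : Superspace (M ⊗[ℂ] N) where
  part := tensorPart S T
  isCompl := isCompl_of_inv _ (TensorProduct.map S.inv T.inv) inv_tensorPart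
    (tensorPart_decomp S T)

end Superspace

/-! ### Lie superalgebras and their supermodules -/

/-- A complex Lie superalgebra. -/
class LieSuperalgebra (𝔤 : Type u) [AddCommGroup 𝔤] [Module ℂ 𝔤] where
  grading : Superspace 𝔤
  br : 𝔤 →ₗ[ℂ] 𝔤 →ₗ[ℂ] 𝔤
  br_mem : ∀ i j, ∀ x ∈ grading.part i, ∀ y ∈ grading.part j, br x y ∈ grading.part (i + j)
  br_skew : ∀ i j, ∀ x ∈ grading.part i, ∀ y ∈ grading.part j,
    br x y = -(sgn (i * j) • br y x)
  br_jacobi : ∀ i j, ∀ x ∈ grading.part i, ∀ y ∈ grading.part j, ∀ z,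
    br x (br y z) = br (br x y) z + sgn (i * j) • br y (br x z)

open LieSuperalgebra

/-- A supermodule structure over the Lie superalgebra `𝔤` on the complex vector space `M`. -/
structure Supermodule (𝔤 : Type u) [AddCommGroup 𝔤] [Module ℂ 𝔤] [LieSuperalgebra 𝔤]
    (M : Type v) [AddCommGroup M] [Module ℂ M] extends Superspace M where
  act : 𝔤 →ₗ[ℂ] Module.End ℂ M
  act_mem : ∀ i j, ∀ x ∈ (grading : Superspace 𝔤).part i, ∀ m ∈ part j, act x m ∈ part (i + j)
  act_br : ∀ i j, ∀ x ∈ (grading : Superspace 𝔤).part i, ∀ y ∈ (grading : Superspace 𝔤).part j,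
    ∀ m, act (br x y) m = act x (act y m) - sgn (i * j) • act y (act x m)

namespace Supermodule

variable {𝔤 : Type u} [AddCommGroup 𝔤] [Module ℂ 𝔤] [LieSuperalgebra 𝔤]
  {M : Type v} [AddCommGroup M] [Module ℂ M] {N : Type w} [AddCommGroup N] [Module ℂ N]

/-- `ρ` is simple: `M ≠ 0`, and the only graded submodules are `0` and `M`. -/
def IsSimple (ρ : Supermodule 𝔤 M) : Prop :=
  Nontrivial M ∧ ∀ W : Submodule ℂ M,
    (∀ m ∈ W, ∀ i, ρ.proj i m ∈ W) → (∀ x, ∀ m ∈ W, ρ.act x m ∈ W) → W = ⊥ ∨ W = ⊤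

/-- The parity shift `Π ρ`. -/
def shift (ρ : Supermodule 𝔤 M) : Supermodule 𝔤 M where
  toSuperspace := ρ.toSuperspace.shift
  act := ρ.act
  act_mem i j x hx m hm := by
    have := ρ.act_mem i (j + 1) x hx m hm
    rwa [← add_assoc] at this
  act_br := ρ.act_br

/-- Isomorphism of supermodules (by maps that are homogeneous of degree zero). -/
def Iso (ρ : Supermodule 𝔤 M) (τ : Supermodule 𝔤 N) : Prop :=
  ∃ e : M ≃ₗ[ℂ] N, (∀ i m, m ∈ ρ.part i ↔ e m ∈ τ.part i) ∧
    ∀ x m, e (ρ.act x m) = τ.act x (e m)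

/-- Isomorphism up to parity change: `ρ ≅ τ` or `ρ ≅ Π τ`. -/
def IsoUpToParity (ρ : Supermodule 𝔤 M) (τ : Supermodule 𝔤 N) : Prop :=
  Iso ρ τ ∨ Iso ρ τ.shift

theorem inv_act (ρ : Supermodule 𝔤 M) (x : 𝔤) (m : M) :
    ρ.inv (ρ.act x m) = ρ.act ((grading : Superspace 𝔤).inv x) (ρ.inv m) := by
  induction x using (grading : Superspace 𝔤).induction with
  | hadd a b ha hb => simp [ha, hb]
  | h i x hx =>
    induction m using ρ.induction with
    | hadd a b ha hb => simp [ha, hb]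
    | h j m hm =>
      rw [ρ.inv_of_mem (ρ.act_mem i j x hx m hm), ρ.inv_of_mem hm,
        (grading : Superspace 𝔤).inv_of_mem hx, map_smul, map_smul, LinearMap.smul_apply,
        smul_smul, sgn_add, mul_comm]

end Supermodule

/-- A sub-superalgebra: a graded subspace closed under the bracket. -/
structure SubSuperalgebra (𝔤 : Type u) [AddCommGroup 𝔤] [Module ℂ 𝔤] [LieSuperalgebra 𝔤] where
  space : Submodule ℂ 𝔤
  proj_mem : ∀ x ∈ space, ∀ i, (grading : Superspace 𝔤).proj i x ∈ space
  br_mem : ∀ x ∈ space, ∀ y ∈ space, br x y ∈ space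

namespace SubSuperalgebra

variable {𝔤 : Type u} [AddCommGroup 𝔤] [Module ℂ 𝔤] [LieSuperalgebra 𝔤]

/-- A sub-superalgebra is a Lie superalgebra with the restricted grading and bracket. -/
instance instLieSuperalgebra (𝔭 : SubSuperalgebra 𝔤) : LieSuperalgebra 𝔭.space where
  grading :=
    { part := fun i => ((grading : Superspace 𝔤).part i).comap 𝔭.space.subtype
      isCompl := by
        constructor
        · rw [Submodule.disjoint_def]
          intro x h0 h1
          have := Submodule.disjoint_def.1 (grading : Superspace 𝔤).isCompl.disjoint x.1 h0 h1
          exact Subtype.ext this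
        · rw [codisjoint_iff, eq_top_iff]
          intro x _
          refine Submodule.mem_sup.2 ⟨⟨_, 𝔭.proj_mem x.1 x.2 0⟩, ?_, ⟨_, 𝔭.proj_mem x.1 x.2 1⟩, ?_,
            Subtype.ext ((grading : Superspace 𝔤).proj_add_proj x.1)⟩
          · exact (grading : Superspace 𝔤).proj_mem 0 x.1
          · exact (grading : Superspace 𝔤).proj_mem 1 x.1 }
  br := LinearMap.mk₂ ℂ (fun x y => ⟨br x.1 y.1, 𝔭.br_mem x.1 x.2 y.1 y.2⟩)
    (fun _ _ _ => Subtype.ext (by simp)) (fun _ _ _ => Subtype.ext (by simp))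
    (fun _ _ _ => Subtype.ext (by simp)) (fun _ _ _ => Subtype.ext (by simp))
  br_mem i j x hx y hy := LieSuperalgebra.br_mem i j x.1 hx y.1 hy
  br_skew i j x hx y hy := Subtype.ext (LieSuperalgebra.br_skew i j x.1 hx y.1 hy)
  br_jacobi i j x hx y hy z := Subtype.ext (LieSuperalgebra.br_jacobi i j x.1 hx y.1 hy z.1)

theorem coe_br (𝔭 : SubSuperalgebra 𝔤) (x y : 𝔭.space) : (br x y : 𝔭.space).1 = br x.1 y.1 := rfl

theorem mem_part_iff (𝔭 : SubSuperalgebra 𝔤) (x : 𝔭.space) (i : ZMod 2) :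
    x ∈ (grading : Superspace 𝔭.space).part i ↔ x.1 ∈ (grading : Superspace 𝔤).part i := Iff.rfl

theorem coe_inv (𝔭 : SubSuperalgebra 𝔤) (x : 𝔭.space) :
    ((grading : Superspace 𝔭.space).inv x).1 = (grading : Superspace 𝔤).inv x.1 := by
  induction x using (grading : Superspace 𝔭.space).induction with
  | hadd a b ha hb => simp [ha, hb]
  | h i x hx =>
    rw [(grading : Superspace 𝔭.space).inv_of_mem hx,
      (grading : Superspace 𝔤).inv_of_mem ((𝔭.mem_part_iff x i).1 hx)]
    rfl

end SubSuperalgebra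

/-! ### The universal enveloping superalgebra -/

/-- The relations `x y - (-1)^{|x||y|} y x = [x, y]`, for `x`, `y` homogeneous. -/
inductive EnvelopingRel (𝔤 : Type u) [AddCommGroup 𝔤] [Module ℂ 𝔤] [LieSuperalgebra 𝔤] :
    TensorAlgebra ℂ 𝔤 → TensorAlgebra ℂ 𝔤 → Prop
  | mk (i j : ZMod 2) (x y : 𝔤) (hx : x ∈ (grading : Superspace 𝔤).part i)
      (hy : y ∈ (grading : Superspace 𝔤).part j) :
      EnvelopingRel 𝔤
        (TensorAlgebra.ι ℂ x * TensorAlgebra.ι ℂ y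
          - sgn (i * j) • (TensorAlgebra.ι ℂ y * TensorAlgebra.ι ℂ x))
        (TensorAlgebra.ι ℂ (br x y))

/-- The universal enveloping superalgebra `U(𝔤)`: the quotient of the tensor algebra by
the two-sided ideal generated by these relations. -/
def Env (𝔤 : Type u) [AddCommGroup 𝔤] [Module ℂ 𝔤] [LieSuperalgebra 𝔤] : Type u :=
  (ringConGen (EnvelopingRel 𝔤)).Quotient
deriving Ring, Algebra ℂ

namespace Env

variable {𝔤 : Type u} [AddCommGroup 𝔤] [Module ℂ 𝔤] [LieSuperalgebra 𝔤]

/-- The quotient map from the tensor algebra. -/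
def mkAlgHom (𝔤 : Type u) [AddCommGroup 𝔤] [Module ℂ 𝔤] [LieSuperalgebra 𝔤] :
    TensorAlgebra ℂ 𝔤 →ₐ[ℂ] Env 𝔤 :=
  RingCon.mkₐ ℂ _

/-- The canonical map `𝔤 → U(𝔤)`. -/
def ι : 𝔤 →ₗ[ℂ] Env 𝔤 :=
  (mkAlgHom 𝔤).toLinearMap ∘ₗ TensorAlgebra.ι ℂ

theorem ι_br {i j : ZMod 2} {x y : 𝔤} (hx : x ∈ (grading : Superspace 𝔤).part i)
    (hy : y ∈ (grading : Superspace 𝔤).part j) :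
    ι (br x y) = ι x * ι y - sgn (i * j) • (ι y * ι x) := by
  have h : mkAlgHom 𝔤 _ = mkAlgHom 𝔤 _ :=
    Quotient.sound (RingCon.le_ringConGen _ _ (EnvelopingRel.mk i j x y hx hy))
  rw [map_sub, map_smul, map_mul, map_mul] at h
  exact h.symm

/-- The universal property of `U(𝔤)`. -/
def lift {A : Type w} [Ring A] [Algebra ℂ A] (f : 𝔤 →ₗ[ℂ] A)
    (hf : ∀ i j, ∀ x ∈ (grading : Superspace 𝔤).part i, ∀ y ∈ (grading : Superspace 𝔤).part j,
      f (br x y) = f x * f y - sgn (i * j) • (f y * f x)) : Env 𝔤 →ₐ[ℂ] A :=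
  RingCon.liftₐ _ (TensorAlgebra.lift ℂ f) <| by
    rw [RingCon.ringConGen_le]
    rintro _ _ ⟨i, j, x, y, hx, hy⟩
    simp [hf i j x hx y hy]

theorem lift_ι {A : Type w} [Ring A] [Algebra ℂ A] (f : 𝔤 →ₗ[ℂ] A)
    (hf : ∀ i j, ∀ x ∈ (grading : Superspace 𝔤).part i, ∀ y ∈ (grading : Superspace 𝔤).part j,
      f (br x y) = f x * f y - sgn (i * j) • (f y * f x)) (x : 𝔤) : lift f hf (ι x) = f x := by
  change TensorAlgebra.lift ℂ f (TensorAlgebra.ι ℂ x) = f x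
  simp

theorem hom_ext {A : Type w} [Ring A] [Algebra ℂ A] {f g : Env 𝔤 →ₐ[ℂ] A}
    (h : ∀ x, f (ι x) = g (ι x)) : f = g := by
  apply RingCon.Quotient.hom_extₐ
  apply TensorAlgebra.hom_ext
  ext x
  exact h x

/-- The parity automorphism of `U(𝔤)`: it is `(-1)^i` on elements of `𝔤` of parity `i`. -/
def parity : Env 𝔤 →ₐ[ℂ] Env 𝔤 :=
  lift (ι ∘ₗ (grading : Superspace 𝔤).inv) (by
    intro i j x hx y hy
    simp only [LinearMap.comp_apply]
    rw [Superspace.inv_of_mem _ (LieSuperalgebra.br_mem i j x hx y hy),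
      Superspace.inv_of_mem _ hx, Superspace.inv_of_mem _ hy]
    simp only [map_smul, smul_mul_smul_comm, ι_br hx hy, sgn_add, smul_sub]
    rw [mul_comm (sgn j), smul_comm (sgn (i * j))])

theorem parity_ι (x : 𝔤) : parity (ι x) = ι ((grading : Superspace 𝔤).inv x) := by
  simp [parity, lift_ι]

theorem parity_parity (a : Env 𝔤) : parity (parity a) = a := by
  have : (parity (𝔤 := 𝔤)).comp parity = AlgHom.id ℂ _ := by
    apply hom_ext
    intro x
    simp [parity_ι, Superspace.inv_inv]
  exact congrArg (fun f => f a) this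

/-- The superspace structure of `U(𝔤)`: products of homogeneous elements of `𝔤` are homogeneous,
of parity the sum of the parities of the factors. -/
def superspace (𝔤 : Type u) [AddCommGroup 𝔤] [Module ℂ 𝔤] [LieSuperalgebra 𝔤] :
    Superspace (Env 𝔤) :=
  Superspace.ofInv parity.toLinearMap parity_parity

theorem mem_part {i : ZMod 2} {a : Env 𝔤} :
    a ∈ (superspace 𝔤).part i ↔ parity a = sgn i • a := Iff.rfl

theorem ι_mem {i : ZMod 2} {x : 𝔤} (hx : x ∈ (grading : Superspace 𝔤).part i) :
    ι x ∈ (superspace 𝔤).part i := by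
  rw [mem_part, parity_ι, Superspace.inv_of_mem _ hx, map_smul]

theorem one_mem : (1 : Env 𝔤) ∈ (superspace 𝔤).part 0 := by
  simp [mem_part]

theorem mul_mem {i j : ZMod 2} {a b : Env 𝔤} (ha : a ∈ (superspace 𝔤).part i)
    (hb : b ∈ (superspace 𝔤).part j) : a * b ∈ (superspace 𝔤).part (i + j) := by
  rw [mem_part] at *
  rw [map_mul, ha, hb, smul_mul_smul_comm, sgn_add]

theorem inv_eq (a : Env 𝔤) : (superspace 𝔤).inv a = parity a := by
  induction a using (superspace 𝔤).induction with
  | hadd a b ha hb => simp [ha, hb]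
  | h i a ha => rw [Superspace.inv_of_mem _ ha, mem_part.1 ha]

end Env

/-! ### Induced supermodules -/

namespace Supermodule

variable {𝔤 : Type u} [AddCommGroup 𝔤] [Module ℂ 𝔤] [LieSuperalgebra 𝔤]

section Ind

variable (𝔭 : SubSuperalgebra 𝔤) {V : Type v} [AddCommGroup V] [Module ℂ V]
  (ρ : Supermodule 𝔭.space V)

/-- The subspace of `U(𝔤) ⊗ V` spanned by the elements `a p ⊗ v - a ⊗ p v` with `p ∈ 𝔭`. -/
def indRel : Submodule ℂ (Env 𝔤 ⊗[ℂ] V) :=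
  Submodule.span ℂ {t | ∃ (a : Env 𝔤) (p : 𝔭.space) (m : V),
    t = (a * Env.ι p.1) ⊗ₜ[ℂ] m - a ⊗ₜ[ℂ] ρ.act p m}

/-- The vector space `U(𝔤) ⊗_{U(𝔭)} V`. -/
abbrev IndSpace : Type max u v := (Env 𝔤 ⊗[ℂ] V) ⧸ indRel 𝔭 ρ

theorem indRel_le_comap_mulLeft (a : Env 𝔤) :
    indRel 𝔭 ρ ≤ (indRel 𝔭 ρ).comap (LinearMap.rTensor V (LinearMap.mulLeft ℂ a)) := by
  refine Submodule.span_le.2 ?_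
  rintro _ ⟨b, p, m, rfl⟩
  refine Submodule.subset_span ⟨a * b, p, m, ?_⟩
  simp [mul_assoc]

theorem indRel_le_comap_inv :
    indRel 𝔭 ρ ≤ (indRel 𝔭 ρ).comap (TensorProduct.map (Env.superspace 𝔤).inv ρ.inv) := by
  refine Submodule.span_le.2 ?_
  rintro _ ⟨b, p, m, rfl⟩
  refine Submodule.subset_span ⟨Env.parity b, (grading : Superspace 𝔭.space).inv p, ρ.inv m, ?_⟩
  simp [Env.inv_eq, Env.parity_ι, inv_act, SubSuperalgebra.coe_inv]

/-- The induced supermodule `Ind_𝔭^𝔤 V = U(𝔤) ⊗_{U(𝔭)} V`, on which `𝔤` acts by left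
multiplication; `a ⊗ v` has parity `|a| + |v|`. -/
def ind : Supermodule 𝔤 (IndSpace 𝔭 ρ) where
  part k := (Superspace.tensorPart (Env.superspace 𝔤) ρ.toSuperspace k).map (indRel 𝔭 ρ).mkQ
  isCompl := by
    refine Superspace.isCompl_of_inv
      (fun k => (Superspace.tensorPart (Env.superspace 𝔤) ρ.toSuperspace k).map (indRel 𝔭 ρ).mkQ)
      (Submodule.mapQ _ _ _ (indRel_le_comap_inv 𝔭 ρ)) ?_ ?_
    · rintro k _ ⟨t, ht, rfl⟩
      rw [Submodule.mkQ_apply, Submodule.mapQ_apply, Superspace.inv_tensorPart k t ht]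
      rfl
    · intro q
      obtain ⟨t, rfl⟩ := (indRel 𝔭 ρ).mkQ_surjective q
      obtain ⟨a, ha, b, hb, rfl⟩ :=
        Superspace.tensorPart_decomp (Env.superspace 𝔤) ρ.toSuperspace t
      exact ⟨_, ⟨a, ha, rfl⟩, _, ⟨b, hb, rfl⟩, by simp⟩
  act :=
    { toFun := fun x => Submodule.mapQ _ _ (LinearMap.rTensor V (LinearMap.mulLeft ℂ (Env.ι x)))
        (indRel_le_comap_mulLeft 𝔭 ρ (Env.ι x))
      map_add' := fun x y => by
        apply Submodule.linearMap_qext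
        ext a m
        simp [add_mul, TensorProduct.add_tmul]
      map_smul' := fun c x => by
        apply Submodule.linearMap_qext
        ext a m
        simp [← TensorProduct.smul_tmul'] }
  act_mem i j x hx q hq := by
    obtain ⟨t, ht, rfl⟩ := hq
    refine ⟨LinearMap.rTensor V (LinearMap.mulLeft ℂ (Env.ι x)) t, ?_, rfl⟩
    induction ht using Submodule.span_induction with
    | mem t h =>
      obtain ⟨k, l, rfl, a, ha, b, hb, rfl⟩ := h
      simp only [LinearMap.rTensor_tmul, LinearMap.mulLeft_apply]
      exact Superspace.tmul_mem_tensorPart (Env.mul_mem (Env.ι_mem hx) ha) hb (add_assoc i k l)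
    | zero => simp
    | add a b _ _ ha hb => rw [map_add]; exact Submodule.add_mem _ ha hb
    | smul c a _ ha => rw [map_smul]; exact Submodule.smul_mem _ c ha
  act_br i j x hx y hy q := by
    obtain ⟨t, rfl⟩ := (indRel 𝔭 ρ).mkQ_surjective q
    simp only [LinearMap.coe_mk, AddHom.coe_mk, Submodule.mkQ_apply, Submodule.mapQ_apply]
    rw [← Submodule.Quotient.mk_smul, ← Submodule.Quotient.mk_sub]
    congr 1
    induction t using TensorProduct.induction_on with
    | zero => simp
    | add a b ha hb => simp only [map_add, ha, hb, smul_add]; abel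
    | tmul a m =>
      simp [Env.ι_br hx hy, sub_mul, TensorProduct.sub_tmul, mul_assoc, ← TensorProduct.smul_tmul']

end Ind

/-! ### Coinduced supermodules -/

section Coind

variable (𝔭 : SubSuperalgebra 𝔤) {V : Type v} [AddCommGroup V] [Module ℂ V]
  (ρ : Supermodule 𝔭.space V)

/-- The linear maps `f : U(𝔤) → V`, homogeneous of parity `i`, such that
`f (p a) = (-1)^{|p||f|} p f(a)` for all homogeneous `p ∈ 𝔭` and all `a ∈ U(𝔤)`. -/
def coindHom (i : ZMod 2) : Submodule ℂ (Env 𝔤 →ₗ[ℂ] V) where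
  carrier := {f | (∀ j, ∀ a ∈ (Env.superspace 𝔤).part j, f a ∈ ρ.part (i + j)) ∧
    ∀ j, ∀ p ∈ (grading : Superspace 𝔭.space).part j, ∀ a,
      f (Env.ι p.1 * a) = sgn (j * i) • ρ.act p (f a)}
  add_mem' := fun {f g} hf hg => ⟨fun j a ha => Submodule.add_mem _ (hf.1 j a ha) (hg.1 j a ha),
    fun j p hp a => by simp [hf.2 j p hp a, hg.2 j p hp a]⟩
  zero_mem' := ⟨fun _ _ _ => Submodule.zero_mem _, fun _ _ _ _ => by simp⟩
  smul_mem' := fun c f hf => ⟨fun j a ha => Submodule.smul_mem _ c (hf.1 j a ha),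
    fun j p hp a => by simp [hf.2 j p hp a, smul_comm c]⟩

/-- The vector space underlying the coinduced supermodule. -/
def coindSpace : Submodule ℂ (Env 𝔤 →ₗ[ℂ] V) := coindHom 𝔭 ρ 0 ⊔ coindHom 𝔭 ρ 1

/-- The type of elements of `coindSpace`. -/
def CoindSpace : Type max u v := coindSpace 𝔭 ρ

instance instAddCommGroupCoindSpace : AddCommGroup (CoindSpace 𝔭 ρ) :=
  inferInstanceAs (AddCommGroup (coindSpace 𝔭 ρ))

instance instModuleCoindSpace : Module ℂ (CoindSpace 𝔭 ρ) :=
  inferInstanceAs (Module ℂ (coindSpace 𝔭 ρ))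

theorem coindHom_le (i : ZMod 2) : coindHom 𝔭 ρ i ≤ coindSpace 𝔭 ρ := by
  rcases zmod_two_cases i with rfl | rfl
  · exact le_sup_left
  · exact le_sup_right

/-- The linear extension in `x` and `f` of `(x f)(a) = (-1)^{|x|(|a|+|f|)} f(a x)`; see
`coindAct_apply`. -/
def coindAct (x : 𝔤) : Module.End ℂ (Env 𝔤 →ₗ[ℂ] V) where
  toFun f := f ∘ₗ LinearMap.mulRight ℂ (Env.ι ((grading : Superspace 𝔤).proj 0 x))
    - ρ.inv ∘ₗ f ∘ₗ LinearMap.mulRight ℂ (Env.ι ((grading : Superspace 𝔤).proj 1 x))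
  map_add' f g := by ext a; simp; abel
  map_smul' c f := by ext a; simp [smul_sub]

theorem coindAct_apply {i j k : ZMod 2} {x : 𝔤} (hx : x ∈ (grading : Superspace 𝔤).part i)
    {f : Env 𝔤 →ₗ[ℂ] V} (hf : f ∈ coindHom 𝔭 ρ j) {a : Env 𝔤}
    (ha : a ∈ (Env.superspace 𝔤).part k) :
    coindAct 𝔭 ρ x f a = sgn (i * (k + j)) • f (a * Env.ι x) := by
  have h1 : (0 : ZMod 2) + 1 = 1 := by decide
  have h2 : (1 : ZMod 2) + 1 = 0 := by decide
  have e1 := (grading : Superspace 𝔤).proj_add_one_of_mem hx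
  have e2 := (grading : Superspace 𝔤).proj_of_mem hx
  have e3 := hf.1 _ _ (Env.mul_mem ha (Env.ι_mem hx))
  rcases zmod_two_cases i with rfl | rfl
  · rw [h1] at e1; simp [coindAct, e1, e2]
  · rw [h2] at e1
    simp only [coindAct, LinearMap.coe_mk, AddHom.coe_mk, e1, e2, LinearMap.sub_apply,
      LinearMap.comp_apply, LinearMap.mulRight_apply, map_zero, mul_zero, zero_sub]
    rw [ρ.inv_of_mem e3]
    simp only [sgn_add, sgn_one, one_mul, mul_neg, mul_one, neg_smul, neg_neg]
    rw [mul_comm (sgn j)]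

theorem coindAct_mem_hom {i j : ZMod 2} {x : 𝔤} (hx : x ∈ (grading : Superspace 𝔤).part i)
    {f : Env 𝔤 →ₗ[ℂ] V} (hf : f ∈ coindHom 𝔭 ρ j) :
    coindAct 𝔭 ρ x f ∈ coindHom 𝔭 ρ (i + j) := by
  refine ⟨fun k a ha => ?_, fun k p hp a => ?_⟩
  · rw [coindAct_apply 𝔭 ρ hx hf ha]
    have := hf.1 _ _ (Env.mul_mem ha (Env.ι_mem hx))
    rw [show i + j + k = j + (k + i) by ring]
    exact Submodule.smul_mem _ _ this
  · induction a using (Env.superspace 𝔤).induction with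
    | hadd a b ha hb => simp [mul_add, ha, hb]
    | h l a ha =>
      rw [coindAct_apply 𝔭 ρ hx hf (Env.mul_mem (Env.ι_mem ((𝔭.mem_part_iff p k).1 hp)) ha), coindAct_apply 𝔭 ρ hx hf ha,
        mul_assoc, hf.2 k p hp, map_smul, smul_smul, smul_smul, ← sgn_add, ← sgn_add]
      congr 2
      ring

theorem coindAct_mem (x : 𝔤) {f : Env 𝔤 →ₗ[ℂ] V} (hf : f ∈ coindSpace 𝔭 ρ) :
    coindAct 𝔭 ρ x f ∈ coindSpace 𝔭 ρ := by
  obtain ⟨f0, h0, f1, h1, rfl⟩ := Submodule.mem_sup.1 hf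
  induction x using (grading : Superspace 𝔤).induction with
  | hadd a b ha hb =>
    have : coindAct 𝔭 ρ (a + b) = coindAct 𝔭 ρ a + coindAct 𝔭 ρ b := by
      ext f c; simp [coindAct, mul_add]; abel
    rw [this]
    exact Submodule.add_mem _ ha hb
  | h i x hx =>
    rw [map_add]
    exact Submodule.add_mem _ (coindHom_le 𝔭 ρ _ (coindAct_mem_hom 𝔭 ρ hx h0))
      (coindHom_le 𝔭 ρ _ (coindAct_mem_hom 𝔭 ρ hx h1))

/-- The coinduced supermodule as a supermodule structure on `coindSpace`. -/
def coindAux : Supermodule 𝔤 (coindSpace 𝔭 ρ) where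
  part i := (coindHom 𝔭 ρ i).comap (coindSpace 𝔭 ρ).subtype
  isCompl := by
    constructor
    · rw [Submodule.disjoint_def]
      rintro ⟨f, hf⟩ h0 h1
      refine Subtype.ext (LinearMap.ext fun a => ?_)
      change f a = 0
      induction a using (Env.superspace 𝔤).induction with
      | hadd a b ha hb => simp [ha, hb]
      | h j a ha =>
        have e0 := h0.1 j a ha
        have e1 := h1.1 j a ha
        rw [zero_add] at e0
        rw [add_comm] at e1
        exact Submodule.disjoint_def.1 (ρ.isCompl_add_one j).disjoint _ e0 e1
    · rw [codisjoint_iff, eq_top_iff]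
      rintro ⟨f, hf⟩ _
      obtain ⟨f0, h0, f1, h1, rfl⟩ := Submodule.mem_sup.1 hf
      exact Submodule.mem_sup.2 ⟨⟨f0, coindHom_le 𝔭 ρ 0 h0⟩, h0, ⟨f1, coindHom_le 𝔭 ρ 1 h1⟩, h1, rfl⟩
  act :=
    { toFun := fun x => (coindAct 𝔭 ρ x).restrict fun _ hf => coindAct_mem 𝔭 ρ x hf
      map_add' := fun x y => by
        ext f a
        simp [coindAct, mul_add, LinearMap.restrict_apply]; abel
      map_smul' := fun c x => by
        ext f a
        simp [coindAct, smul_sub, LinearMap.restrict_apply] }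
  act_mem _ _ _ hx f hf := coindAct_mem_hom 𝔭 ρ hx hf
  act_br i j x hx y hy f := by
    obtain ⟨f, hf⟩ := f
    refine Subtype.ext ?_
    change coindAct 𝔭 ρ (br x y) f = coindAct 𝔭 ρ x (coindAct 𝔭 ρ y f)
      - sgn (i * j) • coindAct 𝔭 ρ y (coindAct 𝔭 ρ x f)
    have key : ∀ k, ∀ g ∈ coindHom 𝔭 ρ k, coindAct 𝔭 ρ (br x y) g =
        coindAct 𝔭 ρ x (coindAct 𝔭 ρ y g) - sgn (i * j) • coindAct 𝔭 ρ y (coindAct 𝔭 ρ x g) := by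
      intro k g hg
      refine LinearMap.ext fun a => ?_
      induction a using (Env.superspace 𝔤).induction with
      | hadd a b ha hb => rw [map_add, map_add, ha, hb]
      | h l a ha =>
        rw [LinearMap.sub_apply, LinearMap.smul_apply,
          coindAct_apply 𝔭 ρ (LieSuperalgebra.br_mem i j x hx y hy) hg ha,
          coindAct_apply 𝔭 ρ hx (coindAct_mem_hom 𝔭 ρ hy hg) ha,
          coindAct_apply 𝔭 ρ hy (coindAct_mem_hom 𝔭 ρ hx hg) ha,
          coindAct_apply 𝔭 ρ hy hg (Env.mul_mem ha (Env.ι_mem hx)),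
          coindAct_apply 𝔭 ρ hx hg (Env.mul_mem ha (Env.ι_mem hy)),
          Env.ι_br hx hy, mul_sub, map_sub, smul_sub, mul_smul_comm, map_smul, smul_smul,
          smul_smul, smul_smul, smul_smul, ← sgn_add, ← sgn_add, ← sgn_add, ← sgn_add,
          mul_assoc, mul_assoc]
        have s1 : ∀ i j k l : ZMod 2,
            i * (l + (j + k)) + j * (l + i + k) = (i + j) * (l + k) := by decide
        have s2 : ∀ i j k l : ZMod 2,
            i * j + (j * (l + (i + k)) + i * (l + j + k)) = (i + j) * (l + k) + i * j := by decide
        rw [s1, add_assoc, s2]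
    obtain ⟨f0, h0, f1, h1, rfl⟩ := Submodule.mem_sup.1 hf
    simp only [map_add, key 0 f0 h0, key 1 f1 h1, smul_add]
    abel

/-- The coinduced supermodule `Coind_𝔭^𝔤 V`: the linear maps `f : U(𝔤) → V` with
`f (p a) = (-1)^{|p||f|} p f(a)` for `p ∈ 𝔭`, with the action
`(x f)(a) = (-1)^{|x|(|a|+|f|)} f(a x)` of `𝔤`. -/
def coind : Supermodule 𝔤 (CoindSpace 𝔭 ρ) := coindAux 𝔭 ρ

end Coind

/-! ### Tensor products and top exterior powers over the even part -/

end Supermodule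

/-- The even part `𝔤₀`. -/
def evenPart (𝔤 : Type u) [AddCommGroup 𝔤] [Module ℂ 𝔤] [LieSuperalgebra 𝔤] :
    SubSuperalgebra 𝔤 where
  space := (grading : Superspace 𝔤).part 0
  proj_mem x hx i := by
    rcases zmod_two_cases i with rfl | rfl
    · exact Superspace.proj_mem _ 0 x
    · have := Superspace.proj_add_one_of_mem _ hx
      rw [zero_add] at this
      rw [this]; exact Submodule.zero_mem _
  br_mem x hx y hy := by
    have := LieSuperalgebra.br_mem 0 0 x hx y hy
    rwa [add_zero] at this

section EvenPart

variable {𝔤 : Type u} [AddCommGroup 𝔤] [Module ℂ 𝔤] [LieSuperalgebra 𝔤]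

theorem evenPart_mem (x : (evenPart 𝔤).space) :
    x ∈ (grading : Superspace (evenPart 𝔤).space).part 0 := x.2

theorem evenPart_eq_zero {x : (evenPart 𝔤).space}
    (hx : x ∈ (grading : Superspace (evenPart 𝔤).space).part 1) : x = 0 :=
  Submodule.disjoint_def.1 (Superspace.isCompl _).disjoint x (evenPart_mem x) hx

/-- A supermodule over the even part, given by a superspace on which the Lie algebra `𝔤₀` acts by
even operators. -/
def Supermodule.ofEven {M : Type v} [AddCommGroup M] [Module ℂ M] (S : Superspace M)
    (act : (evenPart 𝔤).space →ₗ[ℂ] Module.End ℂ M)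
    (hmem : ∀ x i, ∀ m ∈ S.part i, act x m ∈ S.part i)
    (hbr : ∀ x y m, act (br x y) m = act x (act y m) - act y (act x m)) :
    Supermodule (evenPart 𝔤).space M where
  toSuperspace := S
  act := act
  act_mem i j x hx m hm := by
    rcases zmod_two_cases i with rfl | rfl
    · rw [zero_add]; exact hmem x j m hm
    · rw [evenPart_eq_zero hx]; simp
  act_br i j x hx y hy m := by
    rcases zmod_two_cases i with rfl | rfl
    · simp [hbr]
    · rw [evenPart_eq_zero hx]; simp

variable {M : Type v} [AddCommGroup M] [Module ℂ M] {N : Type w} [AddCommGroup N] [Module ℂ N]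

theorem Supermodule.even_act_mem (ρ : Supermodule (evenPart 𝔤).space M) (x : (evenPart 𝔤).space)
    {i : ZMod 2} {m : M} (hm : m ∈ ρ.part i) : ρ.act x m ∈ ρ.part i := by
  have := ρ.act_mem 0 i x (evenPart_mem x) m hm
  rwa [zero_add] at this

theorem Supermodule.even_act_br (ρ : Supermodule (evenPart 𝔤).space M)
    (x y : (evenPart 𝔤).space) (m : M) :
    ρ.act (br x y) m = ρ.act x (ρ.act y m) - ρ.act y (ρ.act x m) := by
  have := ρ.act_br 0 0 x (evenPart_mem x) y (evenPart_mem y) m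
  simpa using this

/-- The tensor product of supermodules over the even part: `x (m ⊗ n) = x m ⊗ n + m ⊗ x n`. -/
def Supermodule.tensor (ρ : Supermodule (evenPart 𝔤).space M)
    (τ : Supermodule (evenPart 𝔤).space N) : Supermodule (evenPart 𝔤).space (M ⊗[ℂ] N) :=
  .ofEven (ρ.toSuperspace.tensor τ.toSuperspace)
    { toFun := fun x => LinearMap.rTensor N (ρ.act x) + LinearMap.lTensor M (τ.act x)
      map_add' := fun x y => by
        rw [map_add, map_add, LinearMap.rTensor_add, LinearMap.lTensor_add]; abel
      map_smul' := fun c x => by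
        rw [map_smul, map_smul, LinearMap.rTensor_smul, LinearMap.lTensor_smul]; simp }
    (by
      intro x k t ht
      change t ∈ Superspace.tensorPart _ _ k at ht
      change _ ∈ Superspace.tensorPart _ _ k
      induction ht using Submodule.span_induction with
      | mem t h =>
        obtain ⟨i, j, rfl, a, ha, b, hb, rfl⟩ := h
        exact Submodule.add_mem _
          (Superspace.tmul_mem_tensorPart (ρ.even_act_mem x ha) hb rfl)
          (Superspace.tmul_mem_tensorPart ha (τ.even_act_mem x hb) rfl)
      | zero => rw [map_zero]; exact Submodule.zero_mem _
      | add a b _ _ ha hb => rw [map_add]; exact Submodule.add_mem _ ha hb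
      | smul c a _ ha => rw [map_smul]; exact Submodule.smul_mem _ c ha)
    (by
      intro x y t
      induction t using TensorProduct.induction_on with
      | zero => simp
      | add a b ha hb => rw [map_add, ha, hb]; simp only [map_add]; abel
      | tmul a b =>
        simp [ρ.even_act_br, τ.even_act_br, TensorProduct.sub_tmul, TensorProduct.tmul_sub]
        abel)

end EvenPart

/-! ### Exterior powers -/

section Exterior

variable {W : Type v} [AddCommGroup W] [Module ℂ W]

theorem update_id_apply {n : ℕ} (i : Fin n) (A : Module.End ℂ W) (w : Fin n → W) :
    (fun k => (Function.update (fun _ => LinearMap.id) i A : Fin n → Module.End ℂ W) k (w k)) =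
      Function.update w i (A (w i)) := by
  funext k
  by_cases h : k = i
  · subst h; simp
  · simp [h]

/-- The alternating map `(w₁, …, wₙ) ↦ ∑ᵢ w₁ ∧ ⋯ ∧ A wᵢ ∧ ⋯ ∧ wₙ`. -/
def extPowerDerivAlt (n : ℕ) (A : Module.End ℂ W) : W [⋀^Fin n]→ₗ[ℂ] ⋀[ℂ]^n W where
  toMultilinearMap := ∑ i, (exteriorPower.ιMulti ℂ n (M := W)).toMultilinearMap.compLinearMap
    (Function.update (fun _ => LinearMap.id) i A)
  map_eq_zero_of_eq' := by
    intro w j k hw hjk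
    change (∑ i, (exteriorPower.ιMulti ℂ n (M := W)).toMultilinearMap.compLinearMap
      (Function.update (fun _ => LinearMap.id) i A)) w = 0
    simp only [sum_apply, MultilinearMap.compLinearMap_apply, update_id_apply]
    rw [Finset.sum_eq_add j k hjk]
    · have h : Function.update w k (A (w k)) =
          Function.update w j (A (w j)) ∘ Equiv.swap j k := by
        funext l
        by_cases hj : l = j
        · subst hj; simp [hjk, Ne.symm hjk, hw]
        · by_cases hk : l = k
          · subst hk; simp [hw]
          · simp [Equiv.swap_apply_of_ne_of_ne hj hk, hj, hk]
      rw [h]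
      change exteriorPower.ιMulti ℂ n _ + exteriorPower.ιMulti ℂ n _ = 0
      rw [AlternatingMap.map_swap _ _ hjk, add_neg_cancel]
    · intro i _ hi
      refine (exteriorPower.ιMulti ℂ n (M := W)).map_eq_zero_of_eq _ ?_ hjk
      simp [hi.1.symm, hi.2.symm, hw]
    · simp
    · simp

/-- The operator `w₁ ∧ ⋯ ∧ wₙ ↦ ∑ᵢ w₁ ∧ ⋯ ∧ A wᵢ ∧ ⋯ ∧ wₙ` on the `n`-th exterior power. -/
def extPowerDeriv (n : ℕ) (A : Module.End ℂ W) : Module.End ℂ (⋀[ℂ]^n W) :=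
  exteriorPower.alternatingMapLinearEquiv (extPowerDerivAlt n A)

theorem extPowerDeriv_ιMulti (n : ℕ) (A : Module.End ℂ W) (w : Fin n → W) :
    extPowerDeriv n A (exteriorPower.ιMulti ℂ n w) =
      ∑ i, exteriorPower.ιMulti ℂ n (Function.update w i (A (w i))) := by
  rw [extPowerDeriv, exteriorPower.alternatingMapLinearEquiv_apply_ιMulti]
  change (∑ i, (exteriorPower.ιMulti ℂ n (M := W)).toMultilinearMap.compLinearMap
      (Function.update (fun _ => LinearMap.id) i A)) w = _
  simp only [sum_apply, MultilinearMap.compLinearMap_apply, update_id_apply]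
  rfl

theorem extPowerDeriv_add (n : ℕ) (A B : Module.End ℂ W) :
    extPowerDeriv n (A + B) = extPowerDeriv n A + extPowerDeriv n B := by
  apply exteriorPower.linearMap_ext
  ext1 w
  simp only [LinearMap.compAlternatingMap_apply, LinearMap.add_apply, extPowerDeriv_ιMulti,
    AlternatingMap.map_update_add, Finset.sum_add_distrib]

theorem extPowerDeriv_smul (n : ℕ) (c : ℂ) (A : Module.End ℂ W) :
    extPowerDeriv n (c • A) = c • extPowerDeriv n A := by
  apply exteriorPower.linearMap_ext
  ext1 w
  simp only [LinearMap.compAlternatingMap_apply, LinearMap.smul_apply, extPowerDeriv_ιMulti,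
    AlternatingMap.map_update_smul, Finset.smul_sum]

theorem extPowerDeriv_lie (n : ℕ) (A B : Module.End ℂ W) :
    extPowerDeriv n (A * B - B * A) =
      extPowerDeriv n A * extPowerDeriv n B - extPowerDeriv n B * extPowerDeriv n A := by
  apply exteriorPower.linearMap_ext
  ext1 w
  simp only [LinearMap.compAlternatingMap_apply, LinearMap.sub_apply, Module.End.mul_apply,
    extPowerDeriv_ιMulti, map_sum]
  rw [Finset.sum_comm (f := fun i j => exteriorPower.ιMulti ℂ n
    (Function.update (Function.update w i (A (w i))) j (B (Function.update w i (A (w i)) j)))),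
    ← Finset.sum_sub_distrib]
  refine Finset.sum_congr rfl fun i _ => ?_
  rw [← Finset.sum_sub_distrib, Finset.sum_eq_single i]
  · simp
  · intro j _ hj
    rw [sub_eq_zero, Function.update_comm hj]
    simp [hj, hj.symm]
  · simp

end Exterior

section Parabolic

variable {𝔤 : Type u} [AddCommGroup 𝔤] [Module ℂ 𝔤] [LieSuperalgebra 𝔤]

/-- For a representation `ψ` of the Lie algebra `𝔤₀` on the vector space `W` of dimension `d`, the
top exterior power `Λ^d W` with the induced action of `𝔤₀`. It has parity `d`, the elements of `W`
being considered as odd. -/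
def topExterior {W : Type v} [AddCommGroup W] [Module ℂ W]
    (ψ : (evenPart 𝔤).space →ₗ[ℂ] Module.End ℂ W)
    (hψ : ∀ x y, ψ (br x y) = ψ x * ψ y - ψ y * ψ x) :
    Supermodule (evenPart 𝔤).space (⋀[ℂ]^(Module.finrank ℂ W) W) :=
  .ofEven (Superspace.pure _ (Module.finrank ℂ W : ZMod 2))
    { toFun := fun x => extPowerDeriv _ (ψ x)
      map_add' := fun x y => by rw [map_add, extPowerDeriv_add]
      map_smul' := fun c x => by rw [map_smul, extPowerDeriv_smul]; rfl }
    (by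
      intro x i m hm
      simp only [Superspace.pure] at hm ⊢
      split_ifs with h
      · exact Submodule.mem_top
      · rw [if_neg h, Submodule.mem_bot] at hm
        rw [hm, map_zero]; exact Submodule.zero_mem _)
    (by
      intro x y m
      simp only [LinearMap.coe_mk, AddHom.coe_mk]
      rw [hψ, extPowerDeriv_lie]
      rfl)

/-- `𝔬` is a `𝔤₀`-submodule of the odd part with `[𝔬, 𝔬] = 0`. -/
structure IsAbelianOdd (𝔬 : Submodule ℂ 𝔤) : Prop where
  le : 𝔬 ≤ (grading : Superspace 𝔤).part 1
  stable : ∀ x ∈ (grading : Superspace 𝔤).part 0, ∀ y ∈ 𝔬, br x y ∈ 𝔬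
  abelian : ∀ x ∈ 𝔬, ∀ y ∈ 𝔬, br x y = 0

namespace IsAbelianOdd

variable {𝔬 : Submodule ℂ 𝔤} (h : IsAbelianOdd 𝔬)

/-- The adjoint action of `𝔤₀` on `𝔬`. -/
def ad : (evenPart 𝔤).space →ₗ[ℂ] Module.End ℂ 𝔬 where
  toFun x := (br x.1).restrict fun y hy => h.stable x.1 x.2 y hy
  map_add' x y := by ext z; simp [LinearMap.restrict_apply]
  map_smul' c x := by ext z; simp [LinearMap.restrict_apply]

theorem ad_br (x y : (evenPart 𝔤).space) : h.ad (br x y) = h.ad x * h.ad y - h.ad y * h.ad x := by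
  ext z
  have := LieSuperalgebra.br_jacobi 0 0 x.1 x.2 y.1 y.2 z.1
  simp only [mul_zero, sgn_zero, one_smul] at this
  exact eq_sub_of_add_eq this.symm

/-- The dual action of `𝔤₀` on `𝔬^*`: `(x φ)(y) = -φ([x, y])`. -/
def coad : (evenPart 𝔤).space →ₗ[ℂ] Module.End ℂ (Module.Dual ℂ 𝔬) where
  toFun x := -(h.ad x).dualMap
  map_add' x y := by ext φ z; simp; abel
  map_smul' c x := by ext φ z; simp

theorem coad_br (x y : (evenPart 𝔤).space) :
    h.coad (br x y) = h.coad x * h.coad y - h.coad y * h.coad x := by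
  ext φ z
  simp [coad, h.ad_br]

/-- The sub-superalgebra `𝔤₀ ⊕ 𝔬`. -/
def parabolic : SubSuperalgebra 𝔤 where
  space := (grading : Superspace 𝔤).part 0 ⊔ 𝔬
  proj_mem x hx i := by
    obtain ⟨a, ha, b, hb, rfl⟩ := Submodule.mem_sup.1 hx
    have e1 := Superspace.proj_add_one_of_mem _ ha
    have e2 := Superspace.proj_add_one_of_mem _ (h.le hb)
    have h2 : (1 : ZMod 2) + 1 = 0 := by decide
    rw [zero_add] at e1
    rw [h2] at e2
    rcases zmod_two_cases i with rfl | rfl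
    · rw [map_add, e2, Superspace.proj_of_mem _ ha, add_zero]
      exact Submodule.mem_sup_left ha
    · rw [map_add, e1, Superspace.proj_of_mem _ (h.le hb), zero_add]
      exact Submodule.mem_sup_right hb
  br_mem x hx y hy := by
    obtain ⟨a, ha, b, hb, rfl⟩ := Submodule.mem_sup.1 hx
    obtain ⟨c, hc, d, hd, rfl⟩ := Submodule.mem_sup.1 hy
    have e1 := LieSuperalgebra.br_mem 0 0 a ha c hc
    have e2 := LieSuperalgebra.br_skew 1 0 b (h.le hb) c hc
    simp only [mul_zero, sgn_zero, one_smul] at e2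
    simp only [map_add, LinearMap.add_apply, h.abelian b hb d hd, e2, add_zero]
    rw [add_zero] at e1
    exact Submodule.add_mem _
      (Submodule.add_mem _ (Submodule.mem_sup_left e1)
        (Submodule.mem_sup_right (𝔬.neg_mem (h.stable c hc b hb))))
      (Submodule.mem_sup_right (h.stable a ha d hd))

theorem mem_of_odd {x : 𝔤} (hx : x ∈ h.parabolic.space)
    (h1 : x ∈ (grading : Superspace 𝔤).part 1) : x ∈ 𝔬 := by
  obtain ⟨a, ha, b, hb, rfl⟩ := Submodule.mem_sup.1 hx
  have : a = 0 := by
    refine Submodule.disjoint_def.1 (grading : Superspace 𝔤).isCompl.disjoint a ha ?_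
    have := Submodule.sub_mem _ h1 (h.le hb)
    rwa [add_sub_cancel_right] at this
  rwa [this, zero_add]

/-- The projection `𝔤₀ ⊕ 𝔬 → 𝔤₀`. -/
def toEven : h.parabolic.space →ₗ[ℂ] (evenPart 𝔤).space :=
  ((grading : Superspace 𝔤).proj 0 ∘ₗ h.parabolic.space.subtype).codRestrict _
    fun x => (grading : Superspace 𝔤).proj_mem 0 x.1

theorem toEven_of_even {x : h.parabolic.space}
    (hx : x ∈ (grading : Superspace h.parabolic.space).part 0) : (h.toEven x).1 = x.1 :=
  (grading : Superspace 𝔤).proj_of_mem hx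

theorem toEven_of_odd {x : h.parabolic.space}
    (hx : x ∈ (grading : Superspace h.parabolic.space).part 1) : h.toEven x = 0 :=
  Subtype.ext ((grading : Superspace 𝔤).proj_add_one_of_mem (i := 1) hx)

/-- The trivial extension to `𝔤₀ ⊕ 𝔬` of a `𝔤₀`-supermodule: `𝔬` acts by zero. -/
def inflate {V : Type v} [AddCommGroup V] [Module ℂ V] (ρ : Supermodule (evenPart 𝔤).space V) :
    Supermodule h.parabolic.space V where
  toSuperspace := ρ.toSuperspace
  act := ρ.act ∘ₗ h.toEven
  act_mem i j x hx m hm := by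
    rcases zmod_two_cases i with rfl | rfl
    · rw [zero_add]; exact ρ.even_act_mem _ hm
    · simp [h.toEven_of_odd hx]
  act_br i j x hx y hy m := by
    simp only [LinearMap.comp_apply]
    have hb := LieSuperalgebra.br_mem i j x hx y hy
    rcases zmod_two_cases i with rfl | rfl <;> rcases zmod_two_cases j with rfl | rfl
    · have : h.toEven (br x y) = br (h.toEven x) (h.toEven y) := by
        refine Subtype.ext ?_
        rw [add_zero] at hb
        rw [h.toEven_of_even hb, SubSuperalgebra.coe_br, SubSuperalgebra.coe_br,
          h.toEven_of_even hx, h.toEven_of_even hy]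
      rw [this, ρ.even_act_br]; simp
    · rw [h.toEven_of_odd hy, h.toEven_of_odd (by simpa using hb)]; simp
    · rw [h.toEven_of_odd hx, h.toEven_of_odd (by simpa using hb)]; simp
    · have : br x y = 0 := Subtype.ext
        (h.abelian x.1 (h.mem_of_odd x.2 hx) y.1 (h.mem_of_odd y.2 hy))
      rw [this, h.toEven_of_odd hx, h.toEven_of_odd hy]; simp

end IsAbelianOdd

/-- A compatible `ℤ`-grading `𝔤 = 𝔤₋₁ ⊕ 𝔤₀ ⊕ 𝔤₁`: here `𝔤₀` is the even part, and the odd part is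
the direct sum of its `𝔤₀`-submodules `𝔤₋₁` (`neg`) and `𝔤₁` (`pos`), with
`[𝔤₁, 𝔤₁] = [𝔤₋₁, 𝔤₋₁] = 0`. -/
structure CompatibleGrading (𝔤 : Type u) [AddCommGroup 𝔤] [Module ℂ 𝔤] [LieSuperalgebra 𝔤] where
  neg : Submodule ℂ 𝔤
  pos : Submodule ℂ 𝔤
  isAbelianOdd_neg : IsAbelianOdd neg
  isAbelianOdd_pos : IsAbelianOdd pos
  disjoint : Disjoint neg pos
  sup_eq : neg ⊔ pos = (grading : Superspace 𝔤).part 1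

namespace CompatibleGrading

variable (G : CompatibleGrading 𝔤) {V : Type v} [AddCommGroup V] [Module ℂ V]
  (ρ : Supermodule (evenPart 𝔤).space V)

/-- The sub-superalgebra `𝔤_{≥0} = 𝔤₀ ⊕ 𝔤₁`. -/
def nonneg : SubSuperalgebra 𝔤 := G.isAbelianOdd_pos.parabolic

/-- The sub-superalgebra `𝔤_{≤0} = 𝔤₀ ⊕ 𝔤₋₁`. -/
def nonpos : SubSuperalgebra 𝔤 := G.isAbelianOdd_neg.parabolic

/-- `V` as a `𝔤_{≥0}`-supermodule, with `𝔤₁ V = 0`. -/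
def extendNonneg : Supermodule G.nonneg.space V := G.isAbelianOdd_pos.inflate ρ

/-- `V` as a `𝔤_{≤0}`-supermodule, with `𝔤₋₁ V = 0`. -/
def extendNonpos : Supermodule G.nonpos.space V := G.isAbelianOdd_neg.inflate ρ

/-- The Kac module `K(V) = Ind_{𝔤_{≥0}}^𝔤 V`. -/
def kac : Supermodule 𝔤 (Supermodule.IndSpace G.nonneg (G.extendNonneg ρ)) :=
  Supermodule.ind G.nonneg (G.extendNonneg ρ)

/-- The opposite Kac module `K'(V) = Ind_{𝔤_{≤0}}^𝔤 V`. -/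
def oppKac : Supermodule 𝔤 (Supermodule.IndSpace G.nonpos (G.extendNonpos ρ)) :=
  Supermodule.ind G.nonpos (G.extendNonpos ρ)

/-- The coinduced module `Coind_{𝔤_{≥0}}^𝔤 V`. -/
def coindNonneg : Supermodule 𝔤 (Supermodule.CoindSpace G.nonneg (G.extendNonneg ρ)) :=
  Supermodule.coind G.nonneg (G.extendNonneg ρ)

/-- The opposite coinduced module `Coind_{𝔤_{≤0}}^𝔤 V`. -/
def coindNonpos : Supermodule 𝔤 (Supermodule.CoindSpace G.nonpos (G.extendNonpos ρ)) :=
  Supermodule.coind G.nonpos (G.extendNonpos ρ)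

/-- `Λ^max(𝔤₋₁)`. -/
def topNeg : Supermodule (evenPart 𝔤).space (⋀[ℂ]^(Module.finrank ℂ G.neg) G.neg) :=
  topExterior G.isAbelianOdd_neg.ad G.isAbelianOdd_neg.ad_br

/-- `Λ^max(𝔤₁)`. -/
def topPos : Supermodule (evenPart 𝔤).space (⋀[ℂ]^(Module.finrank ℂ G.pos) G.pos) :=
  topExterior G.isAbelianOdd_pos.ad G.isAbelianOdd_pos.ad_br

/-- `Λ^max(𝔤₋₁^*)`. -/
def topNegDual : Supermodule (evenPart 𝔤).space
    (⋀[ℂ]^(Module.finrank ℂ (Module.Dual ℂ G.neg)) (Module.Dual ℂ G.neg)) :=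
  topExterior G.isAbelianOdd_neg.coad G.isAbelianOdd_neg.coad_br

/-- `Λ^max(𝔤₁^*)`. -/
def topPosDual : Supermodule (evenPart 𝔤).space
    (⋀[ℂ]^(Module.finrank ℂ (Module.Dual ℂ G.pos)) (Module.Dual ℂ G.pos)) :=
  topExterior G.isAbelianOdd_pos.coad G.isAbelianOdd_pos.coad_br

end CompatibleGrading

end Parabolic

end

/-! Let `d = dim 𝔤₋₁`. The isomorphism `K(V) ≅ Coind(Λ^max(𝔤₋₁) ⊗ V)` is Frobenius reciprocity
applied to a top-degree projection, combined with the perfect pairing `Λ × Λ → Λ^d` on `Λ = Λ(𝔤₋₁)`.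

As a vector space `K(V)` is `Λ ⊗ V`. To see this, `𝔤` is made to act on `Λ ⊗ V`: `𝔤₋₁` by exterior
multiplication, `𝔤₀` by derivations, and `𝔤₁` by `x (y ∧ m) = [x, y] m - y ∧ x m` with `x (1 ⊗ v) =
0` (`modelHom`). The resulting map `K(V) → Λ ⊗ V` has the evident map `Λ ⊗ V → K(V)` as a section
(`kacToModel_modelToKac`), and the latter is onto by commuting `𝔤₀` and `𝔤₁` to the right
(`modelToKac_surjective`). No general Poincaré–Birkhoff–Witt theorem is needed.

In this model `𝔤₀` preserves the exterior degree and `𝔤₁` lowers it by one. Nothing lies above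
degree `d`, so the projection `π : K(V) → Λ^d ⊗ V` kills `𝔤₁ K(V)` and is a homomorphism over
`𝔤_{≥0}` (`kacProj_act`). It therefore induces `m ↦ (a ↦ ± π(a m))` from `K(V)` to the coinduced
module (`iso_coind`).

For bijectivity, restrict functions on `U(𝔤)` to `Λ`. Since `U(𝔤) = U(𝔤_{≥0}) Λ`, a coinduced
function is determined by its restriction (`coindSpace_eq_zero`). Up to signs, the restriction of
the image of `s ⊗ v` is `t ↦ (t s)_max ⊗ v` (`kacProj_envAct`), and this identifies `Λ ⊗ V` with
`Hom(Λ, Λ^d ⊗ V)` because the pairing is perfect and `Λ` is finite-dimensional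
(`topPairingTensor_bijective`). So every function on `Λ` is attained, and with it every coinduced
function. The sizes of `V` and `𝔤₀` play no role.

For the second isomorphism, `V` is replaced by `Λ^max(𝔤₋₁^*) ⊗ V`: on the two top exterior powers
`𝔤₀` acts by opposite characters, `± tr(ad)`, so their tensor product is trivial and even
(`topNeg_tensor_topNegDual_iso`). The statements for `𝔤_{≤0}` are the same ones for the grading with
`𝔤₁` and `𝔤₋₁` exchanged (`swap`). All four isomorphisms come out even, without a parity shift. -/

noncomputable section

universe u v w

open LieSuperalgebra

/-! ### Exterior algebras -/

namespace ExteriorAlgebra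

variable {W : Type v} [AddCommGroup W] [Module ℂ W] {V : Type w} [AddCommGroup V] [Module ℂ V]

/-- The projection of the exterior algebra onto its component of degree `n`. -/
def degProj (W : Type v) [AddCommGroup W] [Module ℂ W] (n : ℕ) :
    ExteriorAlgebra ℂ W →ₗ[ℂ] ⋀[ℂ]^n W :=
  DirectSum.component ℂ ℕ (fun i => ⋀[ℂ]^i W) n ∘ₗ
    (DirectSum.decomposeLinearEquiv (fun i : ℕ => ⋀[ℂ]^i W)).toLinearMap

theorem degProj_of_mem {n : ℕ} {t : ExteriorAlgebra ℂ W} (ht : t ∈ ⋀[ℂ]^n W) :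
    degProj W n t = ⟨t, ht⟩ := by
  refine Subtype.ext ?_
  exact DirectSum.decompose_of_mem_same (fun i : ℕ => ⋀[ℂ]^i W) ht

theorem degProj_of_mem_ne {m n : ℕ} (hmn : m ≠ n) {t : ExteriorAlgebra ℂ W} (ht : t ∈ ⋀[ℂ]^m W) :
    degProj W n t = 0 := by
  refine Subtype.ext ?_
  exact DirectSum.decompose_of_mem_ne (fun i : ℕ => ⋀[ℂ]^i W) ht hmn

theorem ιMulti_mem (n : ℕ) (w : Fin n → W) : ιMulti ℂ n w ∈ ⋀[ℂ]^n W :=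
  ιMulti_range ℂ n ⟨w, rfl⟩

theorem degProj_ιMulti (n : ℕ) (w : Fin n → W) :
    degProj W n (ιMulti ℂ n w) = exteriorPower.ιMulti ℂ n w :=
  degProj_of_mem (ιMulti_mem n w)

/-- A linear map on the exterior algebra is determined by its values on products of vectors. -/
theorem linearMap_ext_ιMulti {f g : ExteriorAlgebra ℂ W →ₗ[ℂ] V}
    (h : ∀ n w, f (ιMulti ℂ n w) = g (ιMulti ℂ n w)) : f = g := by
  refine LinearMap.ext_on (ιMulti_span ℂ W) ?_
  rintro _ ⟨⟨n, w⟩, rfl⟩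
  exact h n w

theorem ιMulti_cons {n : ℕ} (y : W) (w : Fin n → W) :
    ιMulti ℂ (n + 1) (Fin.cons y w : Fin (n + 1) → W) = ι ℂ y * ιMulti ℂ n w := by
  rw [ιMulti_succ_apply]
  rfl

theorem involute_ιMulti (n : ℕ) (w : Fin n → W) :
    CliffordAlgebra.involute (ιMulti ℂ n w) = sgn (n : ZMod 2) • ιMulti ℂ n w := by
  induction n with
  | zero => simp
  | succ n ih =>
    rw [ιMulti_succ_apply, map_mul, ih, CliffordAlgebra.involute_ι, Nat.cast_succ, sgn_add,
      sgn_one, mul_smul_comm, neg_mul, mul_neg, mul_one, neg_smul, smul_neg]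

theorem degProj_involute (n : ℕ) (t : ExteriorAlgebra ℂ W) :
    degProj W n (CliffordAlgebra.involute t) = sgn (n : ZMod 2) • degProj W n t := by
  have : degProj W n ∘ₗ (CliffordAlgebra.involute (Q := (0 : QuadraticForm ℂ W))).toLinearMap =
      sgn (n : ZMod 2) • degProj W n := by
    apply linearMap_ext_ιMulti
    intro m w
    simp only [LinearMap.comp_apply, AlgHom.toLinearMap_apply, LinearMap.smul_apply,
      involute_ιMulti, map_smul]
    by_cases h : m = n
    · subst h; rfl
    · rw [degProj_of_mem_ne h (ιMulti_mem m w), smul_zero, smul_zero]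
  exact LinearMap.congr_fun this t

/-! ### Nondegeneracy of the multiplication into the top degree -/

section Finite

variable [FiniteDimensional ℂ W]

instance instFinite : Module.Finite ℂ (ExteriorAlgebra ℂ W) :=
  Module.Finite.of_basis (Module.finBasis ℂ W).ExteriorAlgebra

theorem finrank_top : Module.finrank ℂ (⋀[ℂ]^(Module.finrank ℂ W) W) = 1 := by
  rw [exteriorPower.finrank_eq, Nat.choose_self]

theorem ιMulti_eq_zero {n : ℕ} (hn : Module.finrank ℂ W < n) (w : Fin n → W) :
    ιMulti ℂ n w = 0 := by
  have : Subsingleton (⋀[ℂ]^n W) := by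
    rw [← Module.finrank_eq_zero_iff_of_free (R := ℂ), exteriorPower.finrank_eq, Nat.choose_eq_zero_of_lt hn]
  exact congrArg Subtype.val (Subsingleton.elim (exteriorPower.ιMulti ℂ n w) 0)

omit [FiniteDimensional ℂ W] in
theorem basis_mul_of_disjoint_finset {I : Type*} [LinearOrder I] (b : Module.Basis I ℂ W)
    {S T : Finset I} (h : Disjoint S T) :
    ∃ c : ℤˣ, b.ExteriorAlgebra S * b.ExteriorAlgebra T =
      c • b.ExteriorAlgebra (S.disjUnion T h) :=
  ⟨_, basis_mul_of_disjoint b (Set.powersetCard.ofCard (s := S) rfl)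
    (Set.powersetCard.ofCard (s := T) rfl) h⟩

omit [FiniteDimensional ℂ W] in
theorem basis_mul_of_not_disjoint_finset {I : Type*} [LinearOrder I] (b : Module.Basis I ℂ W)
    {S T : Finset I} (h : ¬Disjoint S T) : b.ExteriorAlgebra S * b.ExteriorAlgebra T = 0 :=
  basis_mul_of_not_disjoint b (Set.powersetCard.ofCard (s := S) rfl)
    (Set.powersetCard.ofCard (s := T) rfl) h

-- The monomial of the full index set is the only basis monomial of degree `d`, so its coefficient
-- sees only the component of degree `d`.
omit [FiniteDimensional ℂ W] in
theorem coord_univ_degProj {d : ℕ} (b : Module.Basis (Fin d) ℂ W) (t : ExteriorAlgebra ℂ W) :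
    b.ExteriorAlgebra.coord Finset.univ (degProj W d t : ExteriorAlgebra ℂ W) =
      b.ExteriorAlgebra.coord Finset.univ t := by
  have : b.ExteriorAlgebra.coord Finset.univ ∘ₗ (⋀[ℂ]^d W).subtype ∘ₗ degProj W d =
      b.ExteriorAlgebra.coord Finset.univ := by
    refine b.ExteriorAlgebra.ext fun S => ?_
    have hS : b.ExteriorAlgebra S ∈ ⋀[ℂ]^S.card W := by
      rw [basis_apply]; exact ιMulti_mem _ _
    by_cases h : S.card = d
    · rw [h] at hS
      simp only [LinearMap.comp_apply, degProj_of_mem hS, Submodule.subtype_apply]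
    · simp only [LinearMap.comp_apply, degProj_of_mem_ne h hS, map_zero]
      have hne : S ≠ Finset.univ := by
        rintro rfl; simp at h
      simp [Finsupp.single_eq_of_ne hne.symm]
  exact LinearMap.congr_fun this t

-- The product of two monomials is zero or, up to sign, the monomial of the disjoint union of the
-- index sets; the union of `Sᶜ` and `T` is everything only if `T = S`. Together with
-- `coord_univ_mul_self`, this says that the monomials of `Sᶜ` form a dual basis, up to signs, for
-- the top-degree pairing.
omit [FiniteDimensional ℂ W] in
theorem coord_univ_mul {d : ℕ} (b : Module.Basis (Fin d) ℂ W) {S T : Finset (Fin d)} (h : S ≠ T) :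
    b.ExteriorAlgebra.coord Finset.univ (b.ExteriorAlgebra Sᶜ * b.ExteriorAlgebra T) = 0 := by
  by_cases hd : Disjoint Sᶜ T
  · obtain ⟨c, hc⟩ := basis_mul_of_disjoint_finset b hd
    have hne : Sᶜ.disjUnion T hd ≠ Finset.univ := by
      intro hu
      apply h
      ext i
      have h1 : i ∈ Sᶜ.disjUnion T hd := hu ▸ Finset.mem_univ i
      have h2 : i ∈ Sᶜ → i ∉ T := fun hi => Finset.disjoint_left.1 hd hi
      simp only [Finset.mem_disjUnion, Finset.mem_compl] at h1 h2
      tauto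
    rw [hc, LinearMap.map_smul_of_tower, Module.Basis.coord_apply, Module.Basis.repr_self,
      Finsupp.single_eq_of_ne hne.symm, smul_zero]
  · rw [basis_mul_of_not_disjoint_finset b hd, map_zero]

omit [FiniteDimensional ℂ W] in
theorem coord_univ_mul_self {d : ℕ} (b : Module.Basis (Fin d) ℂ W) (S : Finset (Fin d)) :
    b.ExteriorAlgebra.coord Finset.univ (b.ExteriorAlgebra Sᶜ * b.ExteriorAlgebra S) ≠ 0 := by
  obtain ⟨c, hc⟩ := basis_mul_of_disjoint_finset b (disjoint_compl_left (a := S))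
  have hu : Sᶜ.disjUnion S disjoint_compl_left = Finset.univ := by
    ext i; simpa using (Classical.em (i ∈ S)).symm
  rw [hc, hu, LinearMap.map_smul_of_tower, Module.Basis.coord_apply, Module.Basis.repr_self,
    Finsupp.single_eq_same]
  rcases Int.units_eq_one_or c with rfl | rfl <;> simp

/-- The multiplication `Λ W × Λ W → Λ^max W` is nondegenerate. -/
theorem eq_zero_of_degProj_mul {s : ExteriorAlgebra ℂ W}
    (h : ∀ t, degProj W (Module.finrank ℂ W) (t * s) = 0) : s = 0 := by
  let b := Module.finBasis ℂ W
  apply b.ExteriorAlgebra.ext_elem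
  intro S
  -- Multiplying by the complementary monomial and taking the top coefficient picks out the
  -- coordinate of `s` at `S`, up to a nonzero scalar.
  have h1 := coord_univ_degProj b (b.ExteriorAlgebra Sᶜ * s)
  rw [h, Submodule.coe_zero, map_zero] at h1
  have h2 := b.ExteriorAlgebra.sum_repr s
  rw [← h2, Finset.mul_sum, map_sum, Finset.sum_eq_single S] at h1
  · rw [mul_smul_comm, map_smul, smul_eq_mul] at h1
    have := (mul_eq_zero.1 h1.symm).resolve_right (coord_univ_mul_self b S)
    simpa using this
  · intro T _ hT
    rw [mul_smul_comm, map_smul, coord_univ_mul b hT.symm, smul_zero]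
  · simp

/-- The linear map `s ↦ (t ↦ (t s)_max)`. -/
def topPairing (W : Type v) [AddCommGroup W] [Module ℂ W] :
    ExteriorAlgebra ℂ W →ₗ[ℂ] ExteriorAlgebra ℂ W →ₗ[ℂ] ⋀[ℂ]^(Module.finrank ℂ W) W :=
  (LinearMap.mul ℂ (ExteriorAlgebra ℂ W)).flip.compr₂ (degProj W _)

omit [FiniteDimensional ℂ W] in
theorem topPairing_apply (s t : ExteriorAlgebra ℂ W) :
    topPairing W s t = degProj W _ (t * s) := rfl

/-- Nondegeneracy gives injectivity; as `Λ^max W` is a line, both sides have the same finite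
dimension. -/
theorem topPairing_bijective : Function.Bijective (topPairing W) := by
  have hinj : Function.Injective (topPairing W) := by
    rw [injective_iff_map_eq_zero]
    intro s hs
    exact eq_zero_of_degProj_mul fun t => LinearMap.congr_fun hs t
  have hdim : Module.finrank ℂ (ExteriorAlgebra ℂ W) =
      Module.finrank ℂ (ExteriorAlgebra ℂ W →ₗ[ℂ] ⋀[ℂ]^(Module.finrank ℂ W) W) := by
    rw [Module.finrank_linearMap, finrank_top, mul_one]
  refine ⟨hinj, ?_⟩
  have h := LinearMap.injective_iff_surjective_of_finrank_eq_finrank (K := ℂ)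
    (V := ExteriorAlgebra ℂ W)
    (V₂ := ExteriorAlgebra ℂ W →ₗ[ℂ] ⋀[ℂ]^(Module.finrank ℂ W) W) hdim (f := topPairing W)
  exact h.1 hinj

/-- The linear map `Λ W ⊗ V → Hom(Λ W, Λ^max W ⊗ V)`, `s ⊗ v ↦ (t ↦ (t s)_max ⊗ v)`. -/
def topPairingTensor (W : Type v) [AddCommGroup W] [Module ℂ W]
    (V : Type w) [AddCommGroup V] [Module ℂ V] :
    ExteriorAlgebra ℂ W ⊗[ℂ] V →ₗ[ℂ]
      ExteriorAlgebra ℂ W →ₗ[ℂ] ⋀[ℂ]^(Module.finrank ℂ W) W ⊗[ℂ] V :=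
  TensorProduct.rTensorHomToHomRTensor (.id ℂ) _ _ _ ∘ₗ (topPairing W).rTensor V

omit [FiniteDimensional ℂ W] in
theorem topPairingTensor_apply (m : ExteriorAlgebra ℂ W ⊗[ℂ] V) (t : ExteriorAlgebra ℂ W) :
    topPairingTensor W V m t =
      (degProj W _).rTensor V ((LinearMap.mulLeft ℂ t).rTensor V m) := by
  induction m using TensorProduct.induction_on with
  | zero => simp
  | add a b ha hb => simp only [map_add, LinearMap.add_apply, ha, hb]
  | tmul s v => simp [topPairingTensor, topPairing_apply]

/-- `Hom(Λ W, L) ⊗ V → Hom(Λ W, L ⊗ V)` is bijective because `Λ W` is finite-dimensional; `V` may be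
arbitrary. -/
theorem topPairingTensor_bijective : Function.Bijective (topPairingTensor W V) := by
  have h1 : Function.Bijective ((topPairing W).rTensor V) :=
    (LinearEquiv.rTensor V (LinearEquiv.ofBijective _ topPairing_bijective)).bijective
  have h2 : Function.Bijective (TensorProduct.rTensorHomToHomRTensor (.id ℂ)
      (ExteriorAlgebra ℂ W) (⋀[ℂ]^(Module.finrank ℂ W) W) V) := by
    rw [← rTensorHomEquivHomRTensor_toLinearMap]
    exact (rTensorHomEquivHomRTensor ℂ _ _ _).bijective
  exact h2.comp h1

end Finite

end ExteriorAlgebra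

/-! ### Operators on `Λ W ⊗ V` -/

namespace ExteriorAlgebra

variable {W : Type v} [AddCommGroup W] [Module ℂ W] {V : Type w} [AddCommGroup V] [Module ℂ V]

variable (W V) in
/-- The operator `y ∧ -` on `Λ W ⊗ V`, for `y ∈ W`. -/
def wedge : W →ₗ[ℂ] Module.End ℂ (ExteriorAlgebra ℂ W ⊗[ℂ] V) :=
  LinearMap.rTensorHom V ∘ₗ LinearMap.mul ℂ (ExteriorAlgebra ℂ W) ∘ₗ ι ℂ

@[simp] theorem wedge_tmul (y : W) (t : ExteriorAlgebra ℂ W) (v : V) :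
    wedge W V y (t ⊗ₜ v) = (ι ℂ y * t) ⊗ₜ v := rfl

theorem wedge_wedge_self (y : W) (m : ExteriorAlgebra ℂ W ⊗[ℂ] V) :
    wedge W V y (wedge W V y m) = 0 := by
  induction m using TensorProduct.induction_on with
  | zero => simp
  | add a b ha hb => rw [map_add, map_add, ha, hb, add_zero]
  | tmul t v => simp [← mul_assoc]

theorem wedge_wedge_add (y z : W) (m : ExteriorAlgebra ℂ W ⊗[ℂ] V) :
    wedge W V y (wedge W V z m) + wedge W V z (wedge W V y m) = 0 := by
  have := wedge_wedge_self (y + z) m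
  simp only [map_add, LinearMap.add_apply, wedge_wedge_self, zero_add, add_zero] at this
  rwa [add_comm] at this

@[elab_as_elim]
theorem tensor_induction {P : ExteriorAlgebra ℂ W ⊗[ℂ] V → Prop} (one : ∀ v, P (1 ⊗ₜ v))
    (add : ∀ a b, P a → P b → P (a + b)) (wedge : ∀ y m, P m → P (wedge W V y m))
    (m : ExteriorAlgebra ℂ W ⊗[ℂ] V) : P m := by
  induction m using TensorProduct.induction_on with
  | zero => simpa using one 0
  | add a b ha hb => exact add a b ha hb
  | tmul t v =>
    induction t using CliffordAlgebra.left_induction with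
    | algebraMap r =>
      rw [Algebra.algebraMap_eq_smul_one, TensorProduct.smul_tmul]; exact one _
    | add a b ha hb => rw [TensorProduct.add_tmul]; exact add _ _ ha hb
    | ι_mul t y h => exact wedge y _ h

/-- The data defining a linear operator on `Λ W ⊗ V` by recursion. -/
def recStep (ε : ℂ) (c : W →ₗ[ℂ] Module.End ℂ (ExteriorAlgebra ℂ W ⊗[ℂ] V)) :
    W →ₗ[ℂ] (ExteriorAlgebra ℂ W × (V →ₗ[ℂ] ExteriorAlgebra ℂ W ⊗[ℂ] V)) →ₗ[ℂ]
      (V →ₗ[ℂ] ExteriorAlgebra ℂ W ⊗[ℂ] V) :=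
  LinearMap.mk₂ ℂ
    (fun y p => c y ∘ₗ TensorProduct.mk ℂ _ _ p.1 + ε • (wedge W V y ∘ₗ p.2))
    (fun _ _ _ => by ext; simp; abel) (fun a _ _ => by ext; simp [smul_comm a])
    (fun _ _ _ => by ext; simp; abel)
    (fun a _ _ => by ext; simp [smul_comm a])

/-- The consistency condition for recursion on `Λ W`: since `y ∧ y = 0`, applying the step for `y`
twice must give zero. The term in `ε²` vanishes by itself, and the remaining two terms are the
hypothesis `hc`. -/
theorem recStep_recStep {ε : ℂ} {c : W →ₗ[ℂ] Module.End ℂ (ExteriorAlgebra ℂ W ⊗[ℂ] V)}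
    (hc : ∀ y m, c y (wedge W V y m) + ε • wedge W V y (c y m) = 0) 
    (y : W) (t : CliffordAlgebra (0 : QuadraticForm ℂ W))
    (F : V →ₗ[ℂ] ExteriorAlgebra ℂ W ⊗[ℂ] V) :
    recStep ε c y (CliffordAlgebra.ι (0 : QuadraticForm ℂ W) y * t, recStep ε c y (t, F)) =
      (0 : QuadraticForm ℂ W) y • F := by
  ext v
  have := hc y (t ⊗ₜ v)
  simp only [wedge_tmul] at this
  simp only [recStep, LinearMap.mk₂_apply, LinearMap.add_apply, LinearMap.comp_apply,
    TensorProduct.mk_apply, LinearMap.smul_apply, map_add, map_smul, wedge_wedge_self, smul_zero,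
    add_zero, zero_apply, zero_smul, LinearMap.zero_apply]
  exact this

/-- The curried form of `recOp`. -/
def recFold (ε : ℂ) (c : W →ₗ[ℂ] Module.End ℂ (ExteriorAlgebra ℂ W ⊗[ℂ] V))
    (hc : ∀ y m, c y (wedge W V y m) + ε • wedge W V y (c y m) = 0)
    (X₀ : V →ₗ[ℂ] ExteriorAlgebra ℂ W ⊗[ℂ] V) :
    CliffordAlgebra (0 : QuadraticForm ℂ W) →ₗ[ℂ] V →ₗ[ℂ] ExteriorAlgebra ℂ W ⊗[ℂ] V :=
  CliffordAlgebra.foldr' (0 : QuadraticForm ℂ W) (recStep ε c)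
    (fun y t F => recStep_recStep hc y t F) X₀

variable {ε : ℂ} {c : W →ₗ[ℂ] Module.End ℂ (ExteriorAlgebra ℂ W ⊗[ℂ] V)}
  {hc : ∀ y m, c y (wedge W V y m) + ε • wedge W V y (c y m) = 0}
  {X₀ : V →ₗ[ℂ] ExteriorAlgebra ℂ W ⊗[ℂ] V}

theorem recFold_one : recFold ε c hc X₀ 1 = X₀ := by
  have := CliffordAlgebra.foldr'_algebraMap (0 : QuadraticForm ℂ W) (recStep ε c)
    (fun y t F => recStep_recStep hc y t F) X₀ 1
  rwa [map_one, one_smul] at this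

theorem recFold_ι_mul (y : W) (t : CliffordAlgebra (0 : QuadraticForm ℂ W)) :
    recFold ε c hc X₀ (CliffordAlgebra.ι (0 : QuadraticForm ℂ W) y * t) =
      recStep ε c y (t, recFold ε c hc X₀ t) := by
  unfold recFold
  rw [CliffordAlgebra.foldr'_ι_mul]

variable (ε c hc X₀) in
/-- The operator `X` on `Λ W ⊗ V` with `X (1 ⊗ v) = X₀ v` and `X (y ∧ m) = c_y m + ε y ∧ X m`. -/
def recOp : Module.End ℂ (ExteriorAlgebra ℂ W ⊗[ℂ] V) :=
  TensorProduct.lift (recFold ε c hc X₀)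

theorem recOp_one (v : V) : recOp ε c hc X₀ (1 ⊗ₜ v) = X₀ v := by
  rw [recOp, TensorProduct.lift.tmul]
  exact LinearMap.congr_fun recFold_one v

theorem recOp_wedge (y : W) (m : ExteriorAlgebra ℂ W ⊗[ℂ] V) :
    recOp ε c hc X₀ (wedge W V y m) = c y m + ε • wedge W V y (recOp ε c hc X₀ m) := by
  induction m using TensorProduct.induction_on with
  | zero => rw [map_zero, map_zero, map_zero, map_zero, smul_zero, add_zero]
  | add a b ha hb => rw [map_add, map_add, ha, hb, map_add, map_add, map_add, smul_add]; abel
  | tmul t v =>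
    rw [wedge_tmul, recOp, TensorProduct.lift.tmul]
    exact LinearMap.congr_fun (recFold_ι_mul y t) v

end ExteriorAlgebra

/-! ### The universal enveloping superalgebra -/

namespace Env

variable {𝔤 : Type u} [AddCommGroup 𝔤] [Module ℂ 𝔤] [LieSuperalgebra 𝔤]

/-- The universal property yields a homomorphism `U(𝔤) → S`; followed by the inclusion it fixes `𝔤`,
so it is the identity. -/
theorem subalgebra_eq_top {S : Subalgebra ℂ (Env 𝔤)} (h : ∀ x, ι x ∈ S) : S = ⊤ := by
  let f : Env 𝔤 →ₐ[ℂ] S := lift ((ι (𝔤 := 𝔤)).codRestrict S.toSubmodule h) (by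
    intro i j x hx y hy
    exact Subtype.ext (ι_br hx hy))
  have hf : S.val.comp f = AlgHom.id ℂ _ := by
    apply hom_ext
    intro x
    simp only [AlgHom.comp_apply, f, lift_ι]
    rfl
  rw [eq_top_iff]
  intro u _
  have := congrArg (fun g => g u) hf
  simp only [AlgHom.comp_apply, AlgHom.id_apply] at this
  rw [← this]
  exact (f u).2

/-- The elements `a` with `a T ⊆ T` form a subalgebra containing `𝔤`, hence all of `U(𝔤)`; then
apply `a` to `1`. -/
theorem submodule_eq_top {T : Submodule ℂ (Env 𝔤)} (h1 : 1 ∈ T)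
    (h : ∀ x, ∀ u ∈ T, ι x * u ∈ T) : T = ⊤ := by
  let S : Subalgebra ℂ (Env 𝔤) :=
    { carrier := {a | ∀ u ∈ T, a * u ∈ T}
      mul_mem' := fun {a b} ha hb u hu => by rw [mul_assoc]; exact ha _ (hb _ hu)
      add_mem' := fun {a b} ha hb u hu => by rw [add_mul]; exact T.add_mem (ha _ hu) (hb _ hu)
      algebraMap_mem' := fun r u hu => by
        rw [← Algebra.smul_def]; exact T.smul_mem _ hu }
  have hS : S = ⊤ := subalgebra_eq_top fun x u hu => h x u hu
  rw [eq_top_iff]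
  intro u _
  have : u ∈ S := hS ▸ Algebra.mem_top
  simpa using this 1 h1

@[elab_as_elim]
theorem left_induction {P : Env 𝔤 → Prop} (one : P 1) (add : ∀ a b, P a → P b → P (a + b))
    (smul : ∀ (c : ℂ) a, P a → P (c • a)) (ι_mul : ∀ x a, P a → P (ι x * a)) (a : Env 𝔤) : P a := by
  let T : Submodule ℂ (Env 𝔤) :=
    { carrier := {a | P a}
      zero_mem' := by simpa using smul 0 1 one
      add_mem' := fun {a b} ha hb => add a b ha hb
      smul_mem' := fun c a ha => smul c a ha }
  have hT : T = ⊤ := submodule_eq_top one fun x u hu => ι_mul x u hu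
  exact (hT ▸ Submodule.mem_top : a ∈ T)

end Env

/-! ### The opposite grading, the projections to the three components, and the bracket relations by
components -/

namespace CompatibleGrading

variable {𝔤 : Type u} [AddCommGroup 𝔤] [Module ℂ 𝔤] [LieSuperalgebra 𝔤] (G : CompatibleGrading 𝔤)

/-- The opposite compatible grading, in which `𝔤₁` and `𝔤₋₁` are exchanged. -/
def swap : CompatibleGrading 𝔤 where
  neg := G.pos
  pos := G.neg
  isAbelianOdd_neg := G.isAbelianOdd_pos
  isAbelianOdd_pos := G.isAbelianOdd_neg
  disjoint := G.disjoint.symm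
  sup_eq := by rw [sup_comm, G.sup_eq]

theorem exists_add_of_odd {x : 𝔤} (hx : x ∈ (grading : Superspace 𝔤).part 1) :
    ∃ y ∈ G.neg, ∃ z ∈ G.pos, y + z = x := by
  rw [← G.sup_eq] at hx
  exact Submodule.mem_sup.1 hx

/-- The complement is taken to be `𝔤_{≥0}`, so that the projection to `𝔤₋₁` vanishes on it by
construction. -/
theorem isCompl_neg : IsCompl G.neg ((grading : Superspace 𝔤).part 0 ⊔ G.pos) := by
  constructor
  · rw [Submodule.disjoint_def]
    intro y hy h
    have := G.isAbelianOdd_pos.mem_of_odd h (G.isAbelianOdd_neg.le hy)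
    exact Submodule.disjoint_def.1 G.disjoint y hy this
  · rw [codisjoint_iff, sup_comm, sup_assoc, sup_comm G.pos, G.sup_eq]
    exact (grading : Superspace 𝔤).isCompl.sup_eq_top

/-- The projection `𝔤 → 𝔤₋₁`. -/
def projNeg : 𝔤 →ₗ[ℂ] G.neg := Submodule.projectionOnto _ _ G.isCompl_neg

/-- The projection `𝔤 → 𝔤₁`. -/
def projPos : 𝔤 →ₗ[ℂ] G.pos := G.swap.projNeg

/-- The projection `𝔤 → 𝔤₀`. -/
def _root_.LieSuperalgebra.projEven (𝔤 : Type u) [AddCommGroup 𝔤] [Module ℂ 𝔤]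
    [LieSuperalgebra 𝔤] : 𝔤 →ₗ[ℂ] (evenPart 𝔤).space :=
  ((grading : Superspace 𝔤).proj 0).codRestrict _ ((grading : Superspace 𝔤).proj_mem 0)

theorem projNeg_neg (y : G.neg) : G.projNeg y = y :=
  Submodule.projectionOnto_apply_left _ _

theorem projNeg_pos (x : G.pos) : G.projNeg x = 0 :=
  Submodule.projectionOnto_apply_of_mem_right G.isCompl_neg (Submodule.mem_sup_right x.2)

theorem projNeg_even (a : (evenPart 𝔤).space) : G.projNeg a = 0 :=
  Submodule.projectionOnto_apply_of_mem_right G.isCompl_neg (Submodule.mem_sup_left a.2)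

theorem projPos_pos (x : G.pos) : G.projPos x = x := G.swap.projNeg_neg x

theorem projPos_neg (y : G.neg) : G.projPos y = 0 := G.swap.projNeg_pos y

theorem projPos_even (a : (evenPart 𝔤).space) : G.projPos a = 0 := G.swap.projNeg_even a

theorem projEven_even (a : (evenPart 𝔤).space) : projEven 𝔤 a = a :=
  Subtype.ext ((grading : Superspace 𝔤).proj_of_mem a.2)

theorem projEven_odd {x : 𝔤} (hx : x ∈ (grading : Superspace 𝔤).part 1) : projEven 𝔤 x = 0 :=
  Subtype.ext ((grading : Superspace 𝔤).proj_add_one_of_mem (i := 1) hx)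

/-- A linear map from `𝔤` to an associative algebra that is compatible with the brackets of the
components of a compatible grading is compatible with all brackets. -/
theorem bracket_compat {A : Type w} [Ring A] [Algebra ℂ A] (F : 𝔤 →ₗ[ℂ] A)
    (h00 : ∀ a ∈ (grading : Superspace 𝔤).part 0, ∀ b ∈ (grading : Superspace 𝔤).part 0,
      F (br a b) = F a * F b - F b * F a)
    (h0n : ∀ a ∈ (grading : Superspace 𝔤).part 0, ∀ y ∈ G.neg,
      F (br a y) = F a * F y - F y * F a)
    (h0p : ∀ a ∈ (grading : Superspace 𝔤).part 0, ∀ x ∈ G.pos,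
      F (br a x) = F a * F x - F x * F a)
    (hnn : ∀ y ∈ G.neg, ∀ z ∈ G.neg, F y * F z + F z * F y = 0)
    (hpp : ∀ y ∈ G.pos, ∀ z ∈ G.pos, F y * F z + F z * F y = 0)
    (hpn : ∀ x ∈ G.pos, ∀ y ∈ G.neg, F (br x y) = F x * F y + F y * F x) :
    ∀ i j, ∀ x ∈ (grading : Superspace 𝔤).part i, ∀ y ∈ (grading : Superspace 𝔤).part j,
      F (br x y) = F x * F y - sgn (i * j) • (F y * F x) := by
  have h01 : ∀ a ∈ (grading : Superspace 𝔤).part 0, ∀ y ∈ (grading : Superspace 𝔤).part 1,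
      F (br a y) = F a * F y - F y * F a := by
    intro a ha y hy
    obtain ⟨n, hn, p, hp, rfl⟩ := G.exists_add_of_odd hy
    simp only [map_add, h0n a ha n hn, h0p a ha p hp, mul_add, add_mul]
    abel
  intro i j x hx y hy
  rcases zmod_two_cases i with rfl | rfl <;> rcases zmod_two_cases j with rfl | rfl
  · simpa using h00 x hx y hy
  · simpa using h01 x hx y hy
  · rw [br_skew 1 0 x hx y hy]
    simp [h01 y hy x hx]
  · obtain ⟨n, hn, p, hp, rfl⟩ := G.exists_add_of_odd hx
    obtain ⟨n', hn', p', hp', rfl⟩ := G.exists_add_of_odd hy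
    have e := br_skew 1 1 n (G.isAbelianOdd_neg.le hn) p' (G.isAbelianOdd_pos.le hp')
    simp only [mul_one, sgn_one, neg_smul, one_smul, neg_neg] at e
    have e1 := eq_neg_of_add_eq_zero_left (hnn n hn n' hn')
    have e2 := eq_neg_of_add_eq_zero_left (hpp p hp p' hp')
    simp only [map_add, LinearMap.add_apply, G.isAbelianOdd_neg.abelian n hn n' hn',
      G.isAbelianOdd_pos.abelian p hp p' hp', e, hpn p hp n' hn', hpn p' hp' n hn, mul_one,
      sgn_one, neg_smul, one_smul, sub_neg_eq_add, zero_add, add_zero, mul_add, add_mul, e1, e2]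
    abel

end CompatibleGrading

theorem eq_zero_of_eq_neg {M : Type v} [AddCommGroup M] [Module ℂ M] {m : M} (h : m = -m) :
    m = 0 := by
  have : (2 : ℂ) • m = 0 := by
    rw [two_smul]; nth_rewrite 1 [h]; exact neg_add_cancel m
  simpa using this

theorem ExteriorAlgebra.neg_one_smul_tmul {W : Type v} [AddCommGroup W] [Module ℂ W]
    {V : Type w} [AddCommGroup V] [Module ℂ V] (m : ExteriorAlgebra ℂ W ⊗[ℂ] V) :
    (-1 : ℂ) • m = -m :=
  neg_one_smul ℂ m

namespace CompatibleGrading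
open ExteriorAlgebra

/-! ### The action of `𝔤` on `Λ 𝔤₋₁ ⊗ V` -/

section Model

variable {𝔤 : Type u} [AddCommGroup 𝔤] [Module ℂ 𝔤] [LieSuperalgebra 𝔤] (G : CompatibleGrading 𝔤)
  {V : Type v} [AddCommGroup V] [Module ℂ V] (ρ : Supermodule (evenPart 𝔤).space V)

variable (V) in
/-- The vector space `Λ 𝔤₋₁ ⊗ V` underlying the Kac module `K(V)`. -/
abbrev Model : Type max u v := ExteriorAlgebra ℂ G.neg ⊗[ℂ] V

theorem evenOp_compat (A : Module.End ℂ G.neg) (y : G.neg) (m : G.Model V) :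
    (wedge G.neg V ∘ₗ A) y (wedge G.neg V y m)
      + (1 : ℂ) • wedge G.neg V y ((wedge G.neg V ∘ₗ A) y m) = 0 := by
  rw [one_smul]; exact wedge_wedge_add _ _ _

/-- The action of `𝔤₀` on `Λ 𝔤₋₁ ⊗ V`. -/
def evenOp : (evenPart 𝔤).space →ₗ[ℂ] Module.End ℂ (G.Model V) where
  toFun a := recOp 1 (wedge G.neg V ∘ₗ G.isAbelianOdd_neg.ad a) (G.evenOp_compat _)
    (TensorProduct.mk ℂ _ V 1 ∘ₗ ρ.act a)
  map_add' a b := by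
    refine LinearMap.ext fun m => ?_
    induction m using tensor_induction with
    | one v => simp [recOp_one, TensorProduct.tmul_add]
    | add m n hm hn =>
      simp only [map_add] at hm hn ⊢
      rw [hm, hn]
    | wedge y m hm =>
      simp only [recOp_wedge, LinearMap.add_apply, LinearMap.comp_apply, map_add] at hm ⊢
      rw [hm, map_add, smul_add]; abel
  map_smul' r a := by
    refine LinearMap.ext fun m => ?_
    induction m using tensor_induction with
    | one v => simp [recOp_one]
    | add m n hm hn =>
      simp only [map_add] at hm hn ⊢
      rw [hm, hn]
    | wedge y m hm =>
      simp only [recOp_wedge, LinearMap.smul_apply, LinearMap.comp_apply, map_smul,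
        RingHom.id_apply] at hm ⊢
      rw [hm, map_smul, smul_add, smul_comm r]

theorem evenOp_one (a : (evenPart 𝔤).space) (v : V) :
    G.evenOp ρ a (1 ⊗ₜ v) = 1 ⊗ₜ ρ.act a v :=
  recOp_one v

theorem evenOp_wedge (a : (evenPart 𝔤).space) (y : G.neg) (m : G.Model V) :
    G.evenOp ρ a (wedge G.neg V y m) =
      wedge G.neg V (G.isAbelianOdd_neg.ad a y) m + wedge G.neg V y (G.evenOp ρ a m) := by
  have := recOp_wedge (hc := G.evenOp_compat (G.isAbelianOdd_neg.ad a))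
    (X₀ := TensorProduct.mk ℂ _ V 1 ∘ₗ ρ.act a) y m
  rw [one_smul] at this
  exact this

theorem evenOp_br (a b : (evenPart 𝔤).space) (m : G.Model V) :
    G.evenOp ρ (br a b) m = G.evenOp ρ a (G.evenOp ρ b m) - G.evenOp ρ b (G.evenOp ρ a m) := by
  induction m using tensor_induction with
  | one v => simp only [evenOp_one, ρ.even_act_br, TensorProduct.tmul_sub]
  | add m n hm hn => simp only [map_add, hm, hn]; abel
  | wedge y m hm =>
    simp only [evenOp_wedge, map_add, hm, IsAbelianOdd.ad_br, LinearMap.sub_apply,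
      Module.End.mul_apply, map_sub]
    abel

/-- The bracket `𝔤₁ × 𝔤₋₁ → 𝔤₀`. -/
def pairing : G.pos →ₗ[ℂ] G.neg →ₗ[ℂ] (evenPart 𝔤).space :=
  LinearMap.mk₂ ℂ
    (fun x y => ⟨br x.1 y.1,
      br_mem 1 1 x.1 (G.isAbelianOdd_pos.le x.2) y.1 (G.isAbelianOdd_neg.le y.2)⟩)
    (fun _ _ _ => Subtype.ext (by simp)) (fun _ _ _ => Subtype.ext (by simp))
    (fun _ _ _ => Subtype.ext (by simp)) (fun _ _ _ => Subtype.ext (by simp))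

/-- Since `[y, y] = 0`, the Jacobi identity makes `[y, [y, x]]` equal to its own negative. This
vanishing is what makes the recursion for the action of `𝔤₁` consistent. -/
theorem ad_pairing_self (x : G.pos) (y : G.neg) :
    G.isAbelianOdd_neg.ad (G.pairing x y) y = 0 := by
  refine Subtype.ext ?_
  change br (br x.1 y.1) y.1 = 0
  have hx := G.isAbelianOdd_pos.le x.2
  have hy := G.isAbelianOdd_neg.le y.2
  have h1 := br_jacobi 1 1 y.1 hy y.1 hy x.1
  have h2 := br_skew (1 + 1) 1 (br x.1 y.1) (br_mem 1 1 x.1 hx y.1 hy) y.1 hy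
  have h3 := br_skew 1 1 x.1 hx y.1 hy
  have e : (1 : ZMod 2) + 1 = 0 := by decide
  rw [G.isAbelianOdd_neg.abelian y.1 y.2 y.1 y.2] at h1
  simp only [map_zero, LinearMap.zero_apply, zero_add, mul_one, sgn_one, neg_smul, one_smul] at h1
  have h4 : br y.1 (br y.1 x.1) = 0 := eq_zero_of_eq_neg h1
  simp only [mul_one, sgn_one, neg_smul, one_smul, neg_neg] at h3
  rw [h2, h3, h4, smul_zero, neg_zero]

/-- With the odd sign `ε = -1`, commuting `[x, y]` past `y ∧ -` leaves only the term `[[x, y], y] ∧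
m`, which is zero. -/
theorem posOp_compat (x : G.pos) (y : G.neg) (m : G.Model V) :
    (G.evenOp ρ ∘ₗ G.pairing x) y (wedge G.neg V y m)
      + (-1 : ℂ) • wedge G.neg V y ((G.evenOp ρ ∘ₗ G.pairing x) y m) = 0 := by
  simp only [LinearMap.comp_apply, evenOp_wedge, ad_pairing_self, map_zero, LinearMap.zero_apply,
    zero_add, neg_one_smul_tmul, add_neg_cancel]

/-- The action of `𝔤₁` on `Λ 𝔤₋₁ ⊗ V`. -/
def posOp : G.pos →ₗ[ℂ] Module.End ℂ (G.Model V) where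
  toFun x := recOp (-1) (G.evenOp ρ ∘ₗ G.pairing x) (G.posOp_compat ρ x) 0
  map_add' x z := by
    refine LinearMap.ext fun m => ?_
    induction m using tensor_induction with
    | one v => simp [recOp_one]
    | add m n hm hn =>
      simp only [map_add] at hm hn ⊢
      rw [hm, hn]
    | wedge y m hm =>
      simp only [recOp_wedge, LinearMap.add_apply, LinearMap.comp_apply, map_add] at hm ⊢
      rw [hm, map_add, smul_add]; abel
  map_smul' r x := by
    refine LinearMap.ext fun m => ?_
    induction m using tensor_induction with
    | one v => simp [recOp_one]
    | add m n hm hn =>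
      simp only [map_add] at hm hn ⊢
      rw [hm, hn]
    | wedge y m hm =>
      simp only [recOp_wedge, LinearMap.smul_apply, LinearMap.comp_apply, map_smul,
        RingHom.id_apply] at hm ⊢
      rw [hm, map_smul, smul_add, smul_comm r]

theorem posOp_one (x : G.pos) (v : V) : G.posOp ρ x (1 ⊗ₜ v) = 0 :=
  recOp_one v

theorem posOp_wedge (x : G.pos) (y : G.neg) (m : G.Model V) :
    G.posOp ρ x (wedge G.neg V y m) =
      G.evenOp ρ (G.pairing x y) m - wedge G.neg V y (G.posOp ρ x m) := by
  have := recOp_wedge (hc := G.posOp_compat ρ x) (X₀ := 0) y m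
  rw [neg_one_smul_tmul, ← sub_eq_add_neg] at this
  exact this

theorem pairing_ad (a : (evenPart 𝔤).space) (x : G.pos) (y : G.neg) :
    br a (G.pairing x y) = G.pairing (G.isAbelianOdd_pos.ad a x) y
      + G.pairing x (G.isAbelianOdd_neg.ad a y) := by
  refine Subtype.ext ?_
  change br a.1 (br x.1 y.1) = br (br a.1 x.1) y.1 + br x.1 (br a.1 y.1)
  simpa using br_jacobi 0 1 a.1 a.2 x.1 (G.isAbelianOdd_pos.le x.2) y.1

/-- By induction on the number of factors from `𝔤₋₁`: commuting both sides past `y` reduces the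
claim to `[a, [x, y]] = [[a, x], y] + [x, [a, y]]`. -/
theorem posOp_ad (a : (evenPart 𝔤).space) (x : G.pos) (m : G.Model V) :
    G.posOp ρ (G.isAbelianOdd_pos.ad a x) m =
      G.evenOp ρ a (G.posOp ρ x m) - G.posOp ρ x (G.evenOp ρ a m) := by
  induction m using tensor_induction with
  | one v => simp only [posOp_one, evenOp_one, map_zero, sub_zero]
  | add m n hm hn => simp only [map_add, hm, hn]; abel
  | wedge y m hm =>
    have h := G.evenOp_br ρ a (G.pairing x y) m
    rw [pairing_ad, map_add, LinearMap.add_apply] at h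
    simp only [posOp_wedge, evenOp_wedge, map_add, map_sub, hm, eq_sub_of_add_eq h]
    abel

/-- The Jacobi identity for `z`, `x`, `y` together with `[z, x] = 0`. It is the term produced when
two elements of `𝔤₁` are moved past `y`. -/
theorem ad_pairing_add (x z : G.pos) (y : G.neg) :
    G.isAbelianOdd_pos.ad (G.pairing x y) z + G.isAbelianOdd_pos.ad (G.pairing z y) x = 0 := by
  refine Subtype.ext ?_
  change br (br x.1 y.1) z.1 + br (br z.1 y.1) x.1 = 0
  have hx := G.isAbelianOdd_pos.le x.2
  have hz := G.isAbelianOdd_pos.le z.2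
  have hy := G.isAbelianOdd_neg.le y.2
  have h1 := br_jacobi 1 1 z.1 hz x.1 hx y.1
  rw [G.isAbelianOdd_pos.abelian z.1 z.2 x.1 x.2] at h1
  have h2 := br_skew (1 + 1) 1 (br x.1 y.1) (br_mem 1 1 x.1 hx y.1 hy) z.1 hz
  have h3 := br_skew (1 + 1) 1 (br z.1 y.1) (br_mem 1 1 z.1 hz y.1 hy) x.1 hx
  have e : ((1 : ZMod 2) + 1) * 1 = 0 := by decide
  simp only [e, sgn_zero, one_smul] at h2 h3
  simp only [map_zero, LinearMap.zero_apply, zero_add, mul_one, sgn_one, neg_smul, one_smul] at h1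
  rw [h2, h3, h1, neg_neg, add_neg_cancel]

theorem posOp_posOp_add (x z : G.pos) (m : G.Model V) :
    G.posOp ρ x (G.posOp ρ z m) + G.posOp ρ z (G.posOp ρ x m) = 0 := by
  induction m using tensor_induction with
  | one v => simp only [posOp_one, map_zero, add_zero]
  | add m n hm hn =>
    simp only [map_add]
    rw [add_add_add_comm, hm, hn, add_zero]
  | wedge y m hm =>
    have h1 := G.posOp_ad ρ (G.pairing x y) z m
    have h2 := G.posOp_ad ρ (G.pairing z y) x m
    have h3 := congrArg (fun w => G.posOp ρ w m) (G.ad_pairing_add x z y)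
    simp only [map_add, LinearMap.add_apply, h1, h2, map_zero, LinearMap.zero_apply] at h3
    have h4 := congrArg (wedge G.neg V y) hm
    rw [map_add, map_zero] at h4
    simp only [posOp_wedge, map_sub]
    -- The left side is the difference of two vanishing expressions: `y ∧ -` applied to the
    -- induction hypothesis, and the action of `[[x, y], z] + [[z, y], x] = 0`.
    rw [← sub_eq_zero_of_eq (h4.trans h3.symm)]
    abel

/-- The action of `𝔤` on `Λ 𝔤₋₁ ⊗ V`. -/
def modelAct : 𝔤 →ₗ[ℂ] Module.End ℂ (G.Model V) :=
  G.evenOp ρ ∘ₗ projEven 𝔤 + wedge G.neg V ∘ₗ G.projNeg + G.posOp ρ ∘ₗ G.projPos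

theorem modelAct_even (a : (evenPart 𝔤).space) : G.modelAct ρ a = G.evenOp ρ a := by
  simp [modelAct, projEven_even, projNeg_even, projPos_even]

theorem modelAct_neg (y : G.neg) : G.modelAct ρ y = wedge G.neg V y := by
  simp [modelAct, projEven_odd (G.isAbelianOdd_neg.le y.2), projNeg_neg, projPos_neg]

theorem modelAct_pos (x : G.pos) : G.modelAct ρ x = G.posOp ρ x := by
  simp [modelAct, projEven_odd (G.isAbelianOdd_pos.le x.2), projNeg_pos, projPos_pos]

/-- The action of `U(𝔤)` on `Λ 𝔤₋₁ ⊗ V`. -/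
def modelHom : Env 𝔤 →ₐ[ℂ] Module.End ℂ (G.Model V) :=
  Env.lift (A := Module.End ℂ (G.Model V)) (G.modelAct ρ) <| by
    refine G.bracket_compat (A := Module.End ℂ (G.Model V)) (G.modelAct ρ) ?_ ?_ ?_ ?_ ?_ ?_
    · intro a ha b hb
      have h := G.modelAct_even ρ (br ⟨a, ha⟩ ⟨b, hb⟩ : (evenPart 𝔤).space)
      refine Eq.trans h ?_
      rw [G.modelAct_even ρ ⟨a, ha⟩, G.modelAct_even ρ ⟨b, hb⟩]
      refine LinearMap.ext fun m => ?_
      exact G.evenOp_br ρ _ _ m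
    · intro a ha y hy
      refine Eq.trans (G.modelAct_neg ρ (G.isAbelianOdd_neg.ad ⟨a, ha⟩ ⟨y, hy⟩)) ?_
      rw [G.modelAct_even ρ ⟨a, ha⟩, G.modelAct_neg ρ ⟨y, hy⟩]
      refine LinearMap.ext fun m => ?_
      exact eq_sub_of_add_eq (G.evenOp_wedge ρ _ _ m).symm
    · intro a ha x hx
      refine Eq.trans (G.modelAct_pos ρ (G.isAbelianOdd_pos.ad ⟨a, ha⟩ ⟨x, hx⟩)) ?_
      rw [G.modelAct_even ρ ⟨a, ha⟩, G.modelAct_pos ρ ⟨x, hx⟩]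
      refine LinearMap.ext fun m => ?_
      exact G.posOp_ad ρ _ _ m
    · intro y hy z hz
      rw [G.modelAct_neg ρ ⟨y, hy⟩, G.modelAct_neg ρ ⟨z, hz⟩]
      refine LinearMap.ext fun m => ?_
      exact wedge_wedge_add _ _ m
    · intro y hy z hz
      rw [G.modelAct_pos ρ ⟨y, hy⟩, G.modelAct_pos ρ ⟨z, hz⟩]
      refine LinearMap.ext fun m => ?_
      exact G.posOp_posOp_add ρ _ _ m
    · intro x hx y hy
      refine Eq.trans (G.modelAct_even ρ (G.pairing ⟨x, hx⟩ ⟨y, hy⟩)) ?_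
      rw [G.modelAct_pos ρ ⟨x, hx⟩, G.modelAct_neg ρ ⟨y, hy⟩]
      refine LinearMap.ext fun m => ?_
      exact (sub_eq_iff_eq_add.1 (G.posOp_wedge ρ _ _ m).symm).symm ▸ rfl

theorem modelHom_ι (x : 𝔤) : G.modelHom ρ (Env.ι x) = G.modelAct ρ x :=
  Env.lift_ι (A := Module.End ℂ (G.Model V)) _ _ x

end Model

end CompatibleGrading

/-! ### Superspaces and supermodules -/

namespace Superspace

variable {M : Type v} [AddCommGroup M] [Module ℂ M] {N : Type w} [AddCommGroup N] [Module ℂ N]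

/-- The homogeneous components are the eigenspaces of the parity involution. Thus a linear map is
even exactly when it commutes with the involutions, a condition that can be checked on generators.
-/
theorem mem_part_iff_inv (S : Superspace M) {i : ZMod 2} {m : M} :
    m ∈ S.part i ↔ S.inv m = sgn i • m := by
  refine ⟨S.inv_of_mem, fun h => ?_⟩
  have hp := S.proj_add_proj m
  rcases zmod_two_cases i with rfl | rfl
  · have h1 : S.proj 1 m = 0 := by
      have : S.proj 0 m - S.proj 1 m = S.proj 0 m + S.proj 1 m := by
        rw [hp]; simpa [inv] using h
      exact eq_zero_of_eq_neg (by rw [sub_eq_add_neg, add_right_inj] at this; exact this.symm)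
    rw [← hp, h1, add_zero]; exact S.proj_mem 0 m
  · have h0 : S.proj 0 m = 0 := by
      have : S.proj 0 m - S.proj 1 m = -(S.proj 0 m + S.proj 1 m) := by
        rw [hp]; simpa [inv] using h
      exact eq_zero_of_eq_neg (by rw [neg_add, sub_eq_add_neg, add_left_inj] at this; exact this)
    rw [← hp, h0, zero_add]; exact S.proj_mem 1 m

theorem map_inv_of_even (S : Superspace M) (T : Superspace N) (F : M →ₗ[ℂ] N)
    (hF : ∀ i, ∀ m ∈ S.part i, F m ∈ T.part i) (m : M) : F (S.inv m) = T.inv (F m) := by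
  induction m using S.induction with
  | hadd a b ha hb => simp only [map_add, ha, hb]
  | h i m hm => rw [S.inv_of_mem hm, T.inv_of_mem (hF i m hm), map_smul]

theorem even_of_map_inv (S : Superspace M) (T : Superspace N) (F : M →ₗ[ℂ] N)
    (hF : ∀ m, F (S.inv m) = T.inv (F m)) (i : ZMod 2) (m : M) (hm : m ∈ S.part i) :
    F m ∈ T.part i := by
  rw [mem_part_iff_inv, ← hF, S.inv_of_mem hm, map_smul]

theorem inv_tensor_tmul (S : Superspace M) (T : Superspace N) (a : M) (b : N) :
    (S.tensor T).inv (a ⊗ₜ b) = S.inv a ⊗ₜ T.inv b := by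
  induction a using S.induction with
  | hadd a a' ha ha' => simp only [TensorProduct.add_tmul, map_add, ha, ha']
  | h i a ha =>
    induction b using T.induction with
    | hadd b b' hb hb' => simp only [TensorProduct.tmul_add, map_add, hb, hb']
    | h j b hb =>
      rw [(S.tensor T).inv_of_mem (tmul_mem_tensorPart ha hb rfl), S.inv_of_mem ha,
        T.inv_of_mem hb, TensorProduct.smul_tmul_smul, sgn_add]

theorem inv_pure (d : ZMod 2) (m : M) : (pure M d).inv m = sgn d • m := by
  apply inv_of_mem
  simp [pure]

end Superspace

namespace Supermodule

variable {𝔤 : Type u} [AddCommGroup 𝔤] [Module ℂ 𝔤] [LieSuperalgebra 𝔤]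
  {M : Type v} [AddCommGroup M] [Module ℂ M] {N : Type w} [AddCommGroup N] [Module ℂ N]

/-- An even bijection commutes with the parity involutions, so it also reflects parity. -/
theorem Iso.of_bijective {τ : Supermodule 𝔤 M} {ρ : Supermodule 𝔤 N} (F : M →ₗ[ℂ] N)
    (hbij : Function.Bijective F) (heven : ∀ i, ∀ m ∈ τ.part i, F m ∈ ρ.part i)
    (hact : ∀ x m, F (τ.act x m) = ρ.act x (F m)) : Iso τ ρ := by
  refine ⟨LinearEquiv.ofBijective F hbij, fun i m => ⟨heven i m, fun h => ?_⟩, hact⟩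
  rw [τ.mem_part_iff_inv]
  apply hbij.1
  rw [τ.map_inv_of_even ρ.toSuperspace F heven, map_smul]
  exact ρ.inv_of_mem h

theorem Iso.symm {τ : Supermodule 𝔤 M} {ρ : Supermodule 𝔤 N} (h : Iso τ ρ) : Iso ρ τ := by
  obtain ⟨e, h1, h2⟩ := h
  refine ⟨e.symm, fun i m => ?_, fun x m => ?_⟩
  · rw [h1, e.apply_symm_apply]
  · rw [e.symm_apply_eq, h2, e.apply_symm_apply]

theorem Iso.refl (τ : Supermodule 𝔤 M) : Iso τ τ :=
  ⟨LinearEquiv.refl ℂ M, fun _ _ => Iff.rfl, fun _ _ => rfl⟩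

/-- The action of `U(𝔤)` on a `𝔤`-supermodule. -/
def envAct (τ : Supermodule 𝔤 M) : Env 𝔤 →ₐ[ℂ] Module.End ℂ M :=
  Env.lift (A := Module.End ℂ M) τ.act fun i j x hx y hy =>
    LinearMap.ext fun m => τ.act_br i j x hx y hy m

theorem envAct_ι (τ : Supermodule 𝔤 M) (x : 𝔤) : τ.envAct (Env.ι x) = τ.act x :=
  Env.lift_ι (A := Module.End ℂ M) _ _ x

theorem envAct_mul (τ : Supermodule 𝔤 M) (a b : Env 𝔤) (m : M) :
    τ.envAct (a * b) m = τ.envAct a (τ.envAct b m) := by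
  rw [map_mul]; rfl

theorem envAct_one (τ : Supermodule 𝔤 M) (m : M) : τ.envAct 1 m = m := by
  rw [map_one]; rfl

theorem inv_envAct (τ : Supermodule 𝔤 M) (a : Env 𝔤) (m : M) :
    τ.inv (τ.envAct a m) = τ.envAct (Env.parity a) (τ.inv m) := by
  induction a using Env.left_induction with
  | one => simp only [map_one, Module.End.one_apply]
  | add a b ha hb => simp only [map_add, LinearMap.add_apply, ha, hb]
  | smul c a ha => simp only [map_smul, LinearMap.smul_apply, ha]
  | ι_mul x a ha =>
    rw [envAct_mul, envAct_ι, inv_act, ha, map_mul, envAct_mul, Env.parity_ι, envAct_ι]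

theorem envAct_mem (τ : Supermodule 𝔤 M) {i j : ZMod 2} {a : Env 𝔤}
    (ha : a ∈ (Env.superspace 𝔤).part i) {m : M} (hm : m ∈ τ.part j) :
    τ.envAct a m ∈ τ.part (i + j) := by
  rw [τ.mem_part_iff_inv, inv_envAct, Env.mem_part.1 ha, τ.inv_of_mem hm, map_smul, map_smul,
    LinearMap.smul_apply, smul_smul, sgn_add, mul_comm]

/-! ### Homomorphisms to coinduced supermodules -/

section CoindMap

variable {𝔭 : SubSuperalgebra 𝔤} (τ : Supermodule 𝔤 M) (ρ : Supermodule 𝔭.space N)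
  (π : M →ₗ[ℂ] N)

/-- The map `m ↦ (a ↦ (-1)^{|a||m|} π (a m))`; see `coindFun_apply`. -/
def coindFun : M →ₗ[ℂ] Env 𝔤 →ₗ[ℂ] N :=
  LinearMap.mk₂ ℂ (fun m a => π (τ.envAct ((Env.superspace 𝔤).proj 0 a) m)
      - ρ.inv (π (τ.envAct ((Env.superspace 𝔤).proj 1 a) m)))
    (fun _ _ _ => by simp only [map_add]; abel)
    (fun _ _ _ => by simp only [map_smul, smul_sub])
    (fun _ _ _ => by simp only [map_add, LinearMap.add_apply]; abel)
    (fun _ _ _ => by simp only [map_smul, LinearMap.smul_apply, smul_sub])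

theorem coindFun_even {a : Env 𝔤} (ha : a ∈ (Env.superspace 𝔤).part 0) (m : M) :
    coindFun τ ρ π m a = π (τ.envAct a m) := by
  have h := (Env.superspace 𝔤).proj_add_one_of_mem ha
  rw [zero_add] at h
  simp [coindFun, (Env.superspace 𝔤).proj_of_mem ha, h]

theorem coindFun_odd {a : Env 𝔤} (ha : a ∈ (Env.superspace 𝔤).part 1) (m : M) :
    coindFun τ ρ π m a = -ρ.inv (π (τ.envAct a m)) := by
  have h := (Env.superspace 𝔤).proj_add_one_of_mem ha
  rw [show (1 : ZMod 2) + 1 = 0 by decide] at h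
  simp [coindFun, (Env.superspace 𝔤).proj_of_mem ha, h]

variable {τ ρ π} (hπ : ∀ i, ∀ m ∈ τ.part i, π m ∈ ρ.part i)

include hπ in
theorem coindFun_apply {i j : ZMod 2} {a : Env 𝔤} (ha : a ∈ (Env.superspace 𝔤).part i) {m : M}
    (hm : m ∈ τ.part j) : coindFun τ ρ π m a = sgn (i * j) • π (τ.envAct a m) := by
  rcases zmod_two_cases i with rfl | rfl
  · simp [coindFun_even τ ρ π ha]
  · rw [coindFun_odd τ ρ π ha, ρ.inv_of_mem (hπ _ _ (τ.envAct_mem ha hm)), sgn_add]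
    simp

variable (hact : ∀ (p : 𝔭.space) m, π (τ.act p.1 m) = ρ.act p (π m))

-- This is where `π` has to be a homomorphism over `𝔭`. The sign in `coindFun` splits as
-- `(-1)^{(|p|+|a|)|m|} = (-1)^{|p||m|} (-1)^{|a||m|}`, which is the sign rule for a function of
-- parity `|m|`.
include hπ hact in
theorem coindFun_mem_hom {i : ZMod 2} {m : M} (hm : m ∈ τ.part i) :
    coindFun τ ρ π m ∈ coindHom 𝔭 ρ i := by
  refine ⟨fun j a ha => ?_, fun j p hp a => ?_⟩
  · rw [coindFun_apply hπ ha hm, add_comm]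
    exact Submodule.smul_mem _ _ (hπ _ _ (τ.envAct_mem ha hm))
  · induction a using (Env.superspace 𝔤).induction with
    | hadd a b ha hb => simp only [mul_add, map_add, ha, hb, smul_add]
    | h k a ha =>
      rw [coindFun_apply hπ ha hm,
        coindFun_apply hπ (Env.mul_mem (Env.ι_mem ((𝔭.mem_part_iff p j).1 hp)) ha) hm,
        envAct_mul, envAct_ι, hact, map_smul, smul_smul, ← sgn_add, add_mul]

include hπ hact in
theorem coindFun_mem (m : M) : coindFun τ ρ π m ∈ coindSpace 𝔭 ρ := by
  induction m using τ.induction with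
  | hadd a b ha hb => rw [map_add]; exact Submodule.add_mem _ ha hb
  | h i m hm => exact coindHom_le 𝔭 ρ i (coindFun_mem_hom hπ hact hm)

include hπ hact in
theorem coindFun_act (x : 𝔤) (m : M) :
    coindFun τ ρ π (τ.act x m) = coindAct 𝔭 ρ x (coindFun τ ρ π m) := by
  induction m using τ.induction with
  | hadd a b ha hb => simp only [map_add, ha, hb]
  | h j m hm =>
    induction x using (grading : Superspace 𝔤).induction with
    | hadd x y hx hy =>
      have : coindAct 𝔭 ρ (x + y) = coindAct 𝔭 ρ x + coindAct 𝔭 ρ y := by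
        ext f c; simp [coindAct, mul_add]; abel
      rw [this]
      simp only [map_add, LinearMap.add_apply, hx, hy]
    | h i x hx =>
      refine LinearMap.ext fun a => ?_
      induction a using (Env.superspace 𝔤).induction with
      | hadd a b ha hb => rw [map_add, map_add, ha, hb]
      | h k a ha =>
        rw [coindFun_apply hπ ha (τ.act_mem i j x hx m hm),
          coindAct_apply 𝔭 ρ hx (coindFun_mem_hom hπ hact hm) ha,
          coindFun_apply hπ (Env.mul_mem ha (Env.ι_mem hx)) hm, envAct_mul, envAct_ι, smul_smul,
          ← sgn_add]
        congr 2
        -- Both sides of the claim are multiples of `π(a x m)`; the exponents agree because `2 i j =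
        -- 0` modulo 2.
        exact (by decide : ∀ i j k : ZMod 2, k * (i + j) = i * (k + j) + (k + i) * j) i j k

-- Frobenius reciprocity with a criterion for bijectivity: `hinj` says that the kernel of `π`
-- contains no nonzero `U(𝔤)`-submodule. The signs do not affect the kernel, since the even and odd
-- parts of `a` can be treated separately.
include hπ hact in
theorem iso_coind (hinj : ∀ m, (∀ a, π (τ.envAct a m) = 0) → m = 0)
    (hsurj : ∀ f ∈ coindSpace 𝔭 ρ, ∃ m, coindFun τ ρ π m = f) :
    Iso τ (coind 𝔭 ρ) := by
  have key : Iso τ (coindAux 𝔭 ρ) := by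
    refine Iso.of_bijective
      ((coindFun τ ρ π).codRestrict (coindSpace 𝔭 ρ) (coindFun_mem hπ hact)) ⟨?_, ?_⟩
      (fun i m hm => coindFun_mem_hom hπ hact hm)
      (fun x m => Subtype.ext (coindFun_act hπ hact x m))
    · rw [injective_iff_map_eq_zero]
      intro m hm
      have hm' : coindFun τ ρ π m = 0 := congrArg Subtype.val hm
      refine hinj m fun a => ?_
      rw [← (Env.superspace 𝔤).proj_add_proj a, map_add, LinearMap.add_apply, map_add]
      have h0 := coindFun_even τ ρ π ((Env.superspace 𝔤).proj_mem 0 a) m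
      have h1 := coindFun_odd τ ρ π ((Env.superspace 𝔤).proj_mem 1 a) m
      rw [hm', LinearMap.zero_apply] at h0 h1
      have h2 := congrArg ρ.inv h1
      rw [map_neg, ρ.inv_inv, map_zero, zero_eq_neg] at h2
      rw [← h0, h2, add_zero]
    · rintro ⟨f, hf⟩
      obtain ⟨m, hm⟩ := hsurj f hf
      exact ⟨m, Subtype.ext hm⟩
  exact key

end CoindMap

end Supermodule

namespace CompatibleGrading
open ExteriorAlgebra

/-! ### Kac modules -/

section Kac

variable {𝔤 : Type u} [AddCommGroup 𝔤] [Module ℂ 𝔤] [LieSuperalgebra 𝔤] (G : CompatibleGrading 𝔤)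

/-- The canonical homomorphism `Λ 𝔤₋₁ → U(𝔤)`. -/
def extHom : ExteriorAlgebra ℂ G.neg →ₐ[ℂ] Env 𝔤 :=
  ExteriorAlgebra.lift ℂ ⟨Env.ι ∘ₗ G.neg.subtype, fun y => by
    have hy := G.isAbelianOdd_neg.le y.2
    have h := Env.ι_br hy hy
    rw [G.isAbelianOdd_neg.abelian y.1 y.2 y.1 y.2, map_zero, mul_one, sgn_one, neg_smul, one_smul,
      sub_neg_eq_add] at h
    exact eq_zero_of_eq_neg (eq_neg_of_add_eq_zero_left h.symm)⟩

theorem extHom_ι (y : G.neg) : G.extHom (ExteriorAlgebra.ι ℂ y) = Env.ι y.1 :=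
  ExteriorAlgebra.lift_ι_apply ..

theorem parity_extHom (t : ExteriorAlgebra ℂ G.neg) :
    Env.parity (G.extHom t) = G.extHom (CliffordAlgebra.involute t) := by
  induction t using CliffordAlgebra.left_induction with
  | algebraMap r => simp only [AlgHom.commutes]
  | add a b ha hb => simp only [map_add, ha, hb]
  | ι_mul t y h =>
    change Env.parity (G.extHom (ExteriorAlgebra.ι ℂ y * t)) =
      G.extHom (CliffordAlgebra.involute (ExteriorAlgebra.ι ℂ y * t))
    rw [map_mul, map_mul, map_mul, CliffordAlgebra.involute_ι, h, map_mul, map_neg, extHom_ι,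
      Env.parity_ι, Superspace.inv_of_mem _ (G.isAbelianOdd_neg.le y.2), sgn_one, neg_smul,
      one_smul, map_neg]

theorem extHom_ιMulti_mem (n : ℕ) (w : Fin n → G.neg) :
    G.extHom (ιMulti ℂ n w) ∈ (Env.superspace 𝔤).part n := by
  rw [Env.mem_part, parity_extHom, involute_ιMulti, map_smul]

variable {V : Type v} [AddCommGroup V] [Module ℂ V] (ρ : Supermodule (evenPart 𝔤).space V)

theorem extendNonneg_act (p : G.nonneg.space) (v : V) :
    (G.extendNonneg ρ).act p v = ρ.act (projEven 𝔤 p.1) v := rfl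

theorem modelHom_extHom (t s : ExteriorAlgebra ℂ G.neg) (v : V) :
    G.modelHom ρ (G.extHom t) (s ⊗ₜ v) = (t * s) ⊗ₜ v := by
  induction t using CliffordAlgebra.left_induction with
  | algebraMap r =>
    rw [AlgHom.commutes, AlgHom.commutes, ← Algebra.smul_def]; rfl
  | add a b ha hb => simp only [map_add, LinearMap.add_apply, add_mul, TensorProduct.add_tmul, ha, hb]
  | ι_mul t y h =>
    change G.modelHom ρ (G.extHom (ExteriorAlgebra.ι ℂ y * t)) _ =
      (ExteriorAlgebra.ι ℂ y * t * s) ⊗ₜ v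
    rw [map_mul, map_mul, Module.End.mul_apply, h, extHom_ι, modelHom_ι, modelAct_neg, wedge_tmul,
      mul_assoc]

/-- The element `a ⊗ v` of the Kac module. -/
def kacMk : Env 𝔤 ⊗[ℂ] V →ₗ[ℂ] Supermodule.IndSpace G.nonneg (G.extendNonneg ρ) :=
  (Supermodule.indRel G.nonneg (G.extendNonneg ρ)).mkQ

theorem kacMk_mul (a : Env 𝔤) (p : G.nonneg.space) (v : V) :
    G.kacMk ρ ((a * Env.ι p.1) ⊗ₜ v) = G.kacMk ρ (a ⊗ₜ ρ.act (projEven 𝔤 p.1) v) :=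
  (Submodule.Quotient.eq _).2 (Submodule.subset_span ⟨a, p, v, rfl⟩)

theorem kac_act (x : 𝔤) (a : Env 𝔤) (v : V) :
    (G.kac ρ).act x (G.kacMk ρ (a ⊗ₜ v)) = G.kacMk ρ ((Env.ι x * a) ⊗ₜ v) := rfl

theorem kac_envAct (a b : Env 𝔤) (v : V) :
    (G.kac ρ).envAct a (G.kacMk ρ (b ⊗ₜ v)) = G.kacMk ρ ((a * b) ⊗ₜ v) := by
  induction a using Env.left_induction with
  | one => rw [Supermodule.envAct_one, one_mul]
  | add a a' ha ha' =>
    rw [map_add, LinearMap.add_apply, ha, ha', add_mul, TensorProduct.add_tmul, map_add]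
  | smul c a ha =>
    rw [map_smul, LinearMap.smul_apply, ha, smul_mul_assoc, ← TensorProduct.smul_tmul', map_smul]
  | ι_mul x a ha =>
    rw [Supermodule.envAct_mul, ha, Supermodule.envAct_ι, kac_act, mul_assoc]

theorem kac_inv (a : Env 𝔤) (v : V) :
    (G.kac ρ).inv (G.kacMk ρ (a ⊗ₜ v)) = G.kacMk ρ (Env.parity a ⊗ₜ ρ.inv v) := by
  induction a using (Env.superspace 𝔤).induction with
  | hadd a a' ha ha' => simp only [TensorProduct.add_tmul, map_add, ha, ha']
  | h i a ha =>
    induction v using ρ.induction with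
    | hadd b b' hb hb' => simp only [TensorProduct.tmul_add, map_add, hb, hb']
    | h j v hv =>
      have hm : G.kacMk ρ (a ⊗ₜ v) ∈ (G.kac ρ).part (i + j) :=
        ⟨a ⊗ₜ v, Superspace.tmul_mem_tensorPart ha hv rfl, rfl⟩
      rw [(G.kac ρ).inv_of_mem hm, Env.mem_part.1 ha, ρ.inv_of_mem hv,
        TensorProduct.smul_tmul_smul, map_smul, sgn_add]

theorem modelAct_one (p : G.nonneg.space) (v : V) :
    G.modelAct ρ p.1 (1 ⊗ₜ v) = 1 ⊗ₜ ρ.act (projEven 𝔤 p.1) v := by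
  have h : G.projNeg p.1 = 0 := Submodule.projectionOnto_apply_of_mem_right G.isCompl_neg p.2
  simp only [modelAct, LinearMap.add_apply, LinearMap.comp_apply, h, map_zero,
    evenOp_one, posOp_one, add_zero]

/-- The map `K(V) → Λ 𝔤₋₁ ⊗ V`, `a ⊗ v ↦ a (1 ⊗ v)`. -/
def kacToModel : Supermodule.IndSpace G.nonneg (G.extendNonneg ρ) →ₗ[ℂ] G.Model V :=
  (Supermodule.indRel G.nonneg (G.extendNonneg ρ)).liftQ
    (TensorProduct.lift ((LinearMap.lcomp ℂ (G.Model V) (TensorProduct.mk ℂ _ V 1)) ∘ₗ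
      (G.modelHom ρ).toLinearMap)) <| by
    refine Submodule.span_le.2 ?_
    rintro _ ⟨a, p, v, rfl⟩
    change TensorProduct.lift _ _ = 0
    rw [map_sub, TensorProduct.lift.tmul, TensorProduct.lift.tmul, sub_eq_zero]
    change G.modelHom ρ (a * Env.ι p.1) (1 ⊗ₜ v) = G.modelHom ρ a (1 ⊗ₜ _)
    rw [map_mul, Module.End.mul_apply, modelHom_ι, modelAct_one, extendNonneg_act]

theorem kacToModel_mk (a : Env 𝔤) (v : V) :
    G.kacToModel ρ (G.kacMk ρ (a ⊗ₜ v)) = G.modelHom ρ a (1 ⊗ₜ v) := rfl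

theorem kacToModel_act (x : 𝔤) (q : Supermodule.IndSpace G.nonneg (G.extendNonneg ρ)) :
    G.kacToModel ρ ((G.kac ρ).act x q) = G.modelAct ρ x (G.kacToModel ρ q) := by
  obtain ⟨t, rfl⟩ := (Supermodule.indRel G.nonneg (G.extendNonneg ρ)).mkQ_surjective q
  change G.kacToModel ρ ((G.kac ρ).act x (G.kacMk ρ t)) = G.modelAct ρ x (G.kacToModel ρ (G.kacMk ρ t))
  induction t using TensorProduct.induction_on with
  | zero => simp only [map_zero]
  | add a b ha hb => simp only [map_add, ha, hb]
  | tmul a v =>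
    rw [kac_act, kacToModel_mk, kacToModel_mk, map_mul, Module.End.mul_apply, modelHom_ι]

/-- The map `Λ 𝔤₋₁ ⊗ V → K(V)`. -/
def modelToKac : G.Model V →ₗ[ℂ] Supermodule.IndSpace G.nonneg (G.extendNonneg ρ) :=
  G.kacMk ρ ∘ₗ G.extHom.toLinearMap.rTensor V

theorem modelToKac_tmul (t : ExteriorAlgebra ℂ G.neg) (v : V) :
    G.modelToKac ρ (t ⊗ₜ v) = G.kacMk ρ (G.extHom t ⊗ₜ v) := rfl

/-- The linear-independence half of Poincaré–Birkhoff–Witt for `K(V)`: applying `t ∈ Λ 𝔤₋₁` to `1 ⊗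
v` in the model returns `t ⊗ v`. -/
theorem kacToModel_modelToKac (m : G.Model V) : G.kacToModel ρ (G.modelToKac ρ m) = m := by
  induction m using TensorProduct.induction_on with
  | zero => simp only [map_zero]
  | add a b ha hb => rw [map_add, map_add, ha, hb]
  | tmul t v => rw [modelToKac_tmul, kacToModel_mk, modelHom_extHom, mul_one]

theorem act_modelToKac_neg (y : G.neg) (m : G.Model V) :
    (G.kac ρ).act y.1 (G.modelToKac ρ m) = G.modelToKac ρ (wedge G.neg V y m) := by
  induction m using TensorProduct.induction_on with
  | zero => simp only [map_zero]
  | add a b ha hb => simp only [map_add, ha, hb]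
  | tmul t v =>
    rw [wedge_tmul, modelToKac_tmul, modelToKac_tmul, kac_act, map_mul, extHom_ι]

theorem act_modelToKac_one (p : G.nonneg.space) (v : V) :
    (G.kac ρ).act p.1 (G.modelToKac ρ (1 ⊗ₜ v)) =
      G.modelToKac ρ (1 ⊗ₜ ρ.act (projEven 𝔤 p.1) v) := by
  rw [modelToKac_tmul, modelToKac_tmul, kac_act, map_one, mul_one]
  have := G.kacMk_mul ρ 1 p v
  rwa [one_mul] at this

theorem act_even_mem_range (a : (evenPart 𝔤).space) (m : G.Model V) :
    (G.kac ρ).act a.1 (G.modelToKac ρ m) ∈ LinearMap.range (G.modelToKac ρ) := by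
  induction m using tensor_induction with
  | one v =>
    have := G.act_modelToKac_one ρ ⟨a.1, Submodule.mem_sup_left a.2⟩ v
    exact ⟨_, this.symm⟩
  | add m n hm hn => rw [map_add, map_add]; exact Submodule.add_mem _ hm hn
  | wedge y m hm =>
    obtain ⟨n, hn⟩ := hm
    -- Commute `a` to the right: `a y m = [a, y] m + y a m`, where `[a, y]` lies again in `𝔤₋₁`.
    have h := (G.kac ρ).act_br 0 1 a.1 a.2 y.1 (G.isAbelianOdd_neg.le y.2) (G.modelToKac ρ m)
    rw [zero_mul, sgn_zero, one_smul, eq_sub_iff_add_eq] at h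
    rw [← act_modelToKac_neg, ← h, ← hn, act_modelToKac_neg]
    exact Submodule.add_mem _
      ⟨_, (G.act_modelToKac_neg ρ (G.isAbelianOdd_neg.ad a y) m).symm⟩ ⟨_, rfl⟩

theorem act_pos_mem_range (x : G.pos) (m : G.Model V) :
    (G.kac ρ).act x.1 (G.modelToKac ρ m) ∈ LinearMap.range (G.modelToKac ρ) := by
  induction m using tensor_induction with
  | one v =>
    have := G.act_modelToKac_one ρ ⟨x.1, Submodule.mem_sup_right x.2⟩ v
    exact ⟨_, this.symm⟩
  | add m n hm hn => rw [map_add, map_add]; exact Submodule.add_mem _ hm hn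
  | wedge y m hm =>
    obtain ⟨n, hn⟩ := hm
    -- Here `x y m = [x, y] m - y x m` with `[x, y] ∈ 𝔤₀`, so the even case has to come first.
    have h := (G.kac ρ).act_br 1 1 x.1 (G.isAbelianOdd_pos.le x.2) y.1
      (G.isAbelianOdd_neg.le y.2) (G.modelToKac ρ m)
    rw [mul_one, sgn_one, neg_smul, one_smul, sub_neg_eq_add, ← sub_eq_iff_eq_add] at h
    rw [← act_modelToKac_neg, ← h, ← hn, act_modelToKac_neg]
    exact Submodule.sub_mem _ (G.act_even_mem_range ρ (G.pairing x y) m) ⟨_, rfl⟩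

theorem act_mem_range (x : 𝔤) (m : G.Model V) :
    (G.kac ρ).act x (G.modelToKac ρ m) ∈ LinearMap.range (G.modelToKac ρ) := by
  induction x using (grading : Superspace 𝔤).induction with
  | hadd x y hx hy => rw [map_add, LinearMap.add_apply]; exact Submodule.add_mem _ hx hy
  | h i x hx =>
    rcases zmod_two_cases i with rfl | rfl
    · exact G.act_even_mem_range ρ ⟨x, hx⟩ m
    · obtain ⟨y, hy, z, hz, rfl⟩ := G.exists_add_of_odd hx
      rw [map_add, LinearMap.add_apply]
      exact Submodule.add_mem _ ⟨_, (G.act_modelToKac_neg ρ ⟨y, hy⟩ m).symm⟩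
        (G.act_pos_mem_range ρ ⟨z, hz⟩ m)

/-- The range contains every `1 ⊗ v` and is stable under `𝔤`, while `K(V)` is generated over `U(𝔤)`
by these elements. -/
theorem modelToKac_surjective : Function.Surjective (G.modelToKac ρ) := by
  intro q
  obtain ⟨t, rfl⟩ := (Supermodule.indRel G.nonneg (G.extendNonneg ρ)).mkQ_surjective q
  change G.kacMk ρ t ∈ LinearMap.range (G.modelToKac ρ)
  induction t using TensorProduct.induction_on with
  | zero => rw [map_zero]; exact Submodule.zero_mem _
  | add a b ha hb => rw [map_add]; exact Submodule.add_mem _ ha hb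
  | tmul a v =>
    induction a using Env.left_induction with
    | one => exact ⟨1 ⊗ₜ v, by rw [modelToKac_tmul, map_one]⟩
    | add a b ha hb => rw [TensorProduct.add_tmul, map_add]; exact Submodule.add_mem _ ha hb
    | smul c a ha => rw [← TensorProduct.smul_tmul', map_smul]; exact Submodule.smul_mem _ c ha
    | ι_mul x a ha =>
      obtain ⟨m, hm⟩ := ha
      rw [← kac_act, ← hm]
      exact G.act_mem_range ρ x m

/-! ### The projection of the Kac module to its component of lowest degree -/

theorem evenOp_ιMulti (a : (evenPart 𝔤).space) (n : ℕ) (w : Fin n → G.neg) (v : V) :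
    G.evenOp ρ a (ιMulti ℂ n w ⊗ₜ v) =
      (∑ i, ιMulti ℂ n (Function.update w i (G.isAbelianOdd_neg.ad a (w i)))) ⊗ₜ v
        + ιMulti ℂ n w ⊗ₜ ρ.act a v := by
  induction w using Fin.consInduction with
  | elim0 => simp [evenOp_one]
  | cons y w ih =>
    have h := G.evenOp_wedge ρ a y (ιMulti ℂ _ w ⊗ₜ v)
    simp only [wedge_tmul, ih, map_add] at h
    rw [Fin.sum_univ_succ]
    simp only [Fin.update_cons_zero, Fin.cons_zero, Fin.cons_succ, ← Fin.cons_update, ιMulti_cons]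
    rw [h, ← Finset.mul_sum, TensorProduct.add_tmul, add_assoc]

/-- The component `Λᵏ 𝔤₋₁ ⊗ V` of `Λ 𝔤₋₁ ⊗ V`. -/
def degPart (V : Type v) [AddCommGroup V] [Module ℂ V] (k : ℕ) : Submodule ℂ (G.Model V) :=
  Submodule.span ℂ {m | ∃ t ∈ ⋀[ℂ]^k G.neg, ∃ v : V, m = t ⊗ₜ v}

theorem tmul_mem_degPart {k : ℕ} {t : ExteriorAlgebra ℂ G.neg} (ht : t ∈ ⋀[ℂ]^k G.neg) (v : V) :
    t ⊗ₜ[ℂ] v ∈ G.degPart V k :=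
  Submodule.subset_span ⟨t, ht, v, rfl⟩

theorem wedge_mem_degPart {k : ℕ} (y : G.neg) {m : G.Model V} (hm : m ∈ G.degPart V k) :
    wedge G.neg V y m ∈ G.degPart V (k + 1) := by
  induction hm using Submodule.span_induction with
  | mem m h =>
    obtain ⟨t, ht, v, rfl⟩ := h
    refine G.tmul_mem_degPart ?_ v
    rw [ExteriorAlgebra.exteriorPower, pow_succ']
    exact Submodule.mul_mem_mul (LinearMap.mem_range_self _ y) ht
  | zero => rw [map_zero]; exact Submodule.zero_mem _
  | add a b _ _ ha hb => rw [map_add]; exact Submodule.add_mem _ ha hb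
  | smul c a _ ha => rw [map_smul]; exact Submodule.smul_mem _ c ha

theorem evenOp_ιMulti_mem (a : (evenPart 𝔤).space) (n : ℕ) (w : Fin n → G.neg) (v : V) :
    G.evenOp ρ a (ιMulti ℂ n w ⊗ₜ v) ∈ G.degPart V n := by
  rw [evenOp_ιMulti]
  exact Submodule.add_mem _
    (G.tmul_mem_degPart (Submodule.sum_mem _ fun i _ => ιMulti_mem _ _) _)
    (G.tmul_mem_degPart (ιMulti_mem _ _) _)

/-- `𝔤₁` lowers the exterior degree by one: in `x (y ∧ m) = [x, y] m - y ∧ x m` the first term has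
the degree of `m`, and the second one by induction. -/
theorem posOp_ιMulti_mem (x : G.pos) (n : ℕ) (w : Fin (n + 1) → G.neg) (v : V) :
    G.posOp ρ x (ιMulti ℂ (n + 1) w ⊗ₜ v) ∈ G.degPart V n := by
  induction n with
  | zero =>
    rw [← Fin.cons_self_tail w, ιMulti_cons, ← wedge_tmul, posOp_wedge, ιMulti_zero_apply,
      posOp_one, map_zero, sub_zero, evenOp_one]
    exact G.tmul_mem_degPart (by simp [ExteriorAlgebra.exteriorPower]) _
  | succ n ih =>
    rw [← Fin.cons_self_tail w, ιMulti_cons, ← wedge_tmul, posOp_wedge]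
    exact Submodule.sub_mem _ (G.evenOp_ιMulti_mem ρ _ _ _ v)
      (G.wedge_mem_degPart _ (ih _))

theorem degProj_of_mem_degPart {k d : ℕ} (h : k ≠ d) {m : G.Model V} (hm : m ∈ G.degPart V k) :
    (degProj G.neg d).rTensor V m = 0 := by
  induction hm using Submodule.span_induction with
  | mem m hm =>
    obtain ⟨t, ht, v, rfl⟩ := hm
    rw [LinearMap.rTensor_tmul, degProj_of_mem_ne h ht, TensorProduct.zero_tmul]
  | zero => rw [map_zero]
  | add a b _ _ ha hb => rw [map_add, ha, hb, add_zero]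
  | smul c a _ ha => rw [map_smul, ha, smul_zero]

@[elab_as_elim]
theorem model_induction {P : G.Model V → Prop} (add : ∀ a b, P a → P b → P (a + b))
    (ιMulti : ∀ n (w : Fin n → G.neg) v, P (ιMulti ℂ n w ⊗ₜ v)) (m : G.Model V) : P m := by
  have h0 : P 0 := by simpa using ιMulti 0 0 0
  induction m using TensorProduct.induction_on with
  | zero => exact h0
  | add a b ha hb => exact add a b ha hb
  | tmul t v =>
    have ht : t ∈ Submodule.span ℂ (Set.range fun x : Σ n, (Fin n → G.neg) =>
        ExteriorAlgebra.ιMulti ℂ x.1 x.2) := ιMulti_span ℂ G.neg ▸ Submodule.mem_top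
    induction ht using Submodule.span_induction generalizing v with
    | mem t h =>
      obtain ⟨⟨n, w⟩, rfl⟩ := h
      exact ιMulti n w v
    | zero => rwa [TensorProduct.zero_tmul]
    | add a b _ _ ha hb => rw [TensorProduct.add_tmul]; exact add _ _ (ha v) (hb v)
    -- The scalar is moved onto `v`, since `P` is not assumed stable under scalars; hence the
    -- induction is over all `v`.
    | smul c a _ ha => rw [TensorProduct.smul_tmul]; exact ha _

end Kac

end CompatibleGrading

/-! ### The top-degree projection as a homomorphism over `𝔤_{≥0}` -/

namespace CompatibleGrading
open ExteriorAlgebra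

section Coind

variable {𝔤 : Type u} [AddCommGroup 𝔤] [Module ℂ 𝔤] [LieSuperalgebra 𝔤] (G : CompatibleGrading 𝔤)
  {V : Type v} [AddCommGroup V] [Module ℂ V] (ρ : Supermodule (evenPart 𝔤).space V)

theorem tensor_act_tmul {M : Type v} [AddCommGroup M] [Module ℂ M] {N : Type w} [AddCommGroup N]
    [Module ℂ N] (ρ : Supermodule (evenPart 𝔤).space M) (τ : Supermodule (evenPart 𝔤).space N)
    (a : (evenPart 𝔤).space) (m : M) (n : N) :
    (ρ.tensor τ).act a (m ⊗ₜ n) = ρ.act a m ⊗ₜ n + m ⊗ₜ τ.act a n := rfl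

/-- `𝔤₀` preserves the exterior degree, and in top degree its action is by definition the induced
one on `Λ^max` tensored with `V`. -/
theorem degProj_evenOp (a : (evenPart 𝔤).space) (m : G.Model V) :
    (degProj G.neg _).rTensor V (G.evenOp ρ a m) =
      (G.topNeg.tensor ρ).act a ((degProj G.neg _).rTensor V m) := by
  induction m using G.model_induction with
  | add m n hm hn => simp only [map_add, hm, hn]
  | ιMulti n w v =>
    by_cases h : n = Module.finrank ℂ G.neg
    · subst h
      rw [evenOp_ιMulti, map_add, LinearMap.rTensor_tmul, LinearMap.rTensor_tmul,
        LinearMap.rTensor_tmul, map_sum, degProj_ιMulti, tensor_act_tmul]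
      simp only [degProj_ιMulti]
      congr 2
      exact (extPowerDeriv_ιMulti _ (G.isAbelianOdd_neg.ad a) w).symm
    · rw [G.degProj_of_mem_degPart h (G.evenOp_ιMulti_mem ρ a n w v),
        G.degProj_of_mem_degPart h (G.tmul_mem_degPart (ιMulti_mem n w) v), map_zero]

/-- A top-degree component of `x m` could only come from degree one higher, where the exterior power
is zero. -/
theorem degProj_posOp [FiniteDimensional ℂ G.neg] (x : G.pos) (m : G.Model V) :
    (degProj G.neg (Module.finrank ℂ G.neg)).rTensor V (G.posOp ρ x m) = 0 := by
  induction m using G.model_induction with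
  | add m n hm hn => rw [map_add, map_add, hm, hn, add_zero]
  | ιMulti n w v =>
    cases n with
    | zero => rw [ιMulti_zero_apply, posOp_one, map_zero]
    | succ n =>
      by_cases h : n = Module.finrank ℂ G.neg
      · rw [ιMulti_eq_zero (by omega), TensorProduct.zero_tmul, map_zero, map_zero]
      · exact G.degProj_of_mem_degPart h (G.posOp_ιMulti_mem ρ x n w v)

/-- The projection `K(V) → Λ^max 𝔤₋₁ ⊗ V`. -/
def kacProj : Supermodule.IndSpace G.nonneg (G.extendNonneg ρ) →ₗ[ℂ]
    ⋀[ℂ]^(Module.finrank ℂ G.neg) G.neg ⊗[ℂ] V :=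
  (degProj G.neg _).rTensor V ∘ₗ G.kacToModel ρ

theorem kacProj_act [FiniteDimensional ℂ G.neg] (p : G.nonneg.space)
    (q : Supermodule.IndSpace G.nonneg (G.extendNonneg ρ)) :
    G.kacProj ρ ((G.kac ρ).act p.1 q) =
      (G.topNeg.tensor ρ).act (projEven 𝔤 p.1) (G.kacProj ρ q) := by
  have h : G.projNeg p.1 = 0 := Submodule.projectionOnto_apply_of_mem_right G.isCompl_neg p.2
  rw [kacProj, LinearMap.comp_apply, LinearMap.comp_apply, kacToModel_act, ← degProj_evenOp]
  simp only [modelAct, LinearMap.add_apply, LinearMap.comp_apply, h, map_zero, map_add,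
    degProj_posOp, add_zero]

/-- The parity automorphism is `(-1)^d` on `Λ^d`, which matches the parity `d` assigned to `Λ^max`.
This is why no parity shift appears. -/
theorem kacProj_even (i : ZMod 2) (q : Supermodule.IndSpace G.nonneg (G.extendNonneg ρ))
    (hq : q ∈ (G.kac ρ).part i) : G.kacProj ρ q ∈ (G.topNeg.tensor ρ).part i := by
  refine Superspace.even_of_map_inv (G.kac ρ).toSuperspace (G.topNeg.tensor ρ).toSuperspace
    (G.kacProj ρ) (fun q => ?_) i q hq
  obtain ⟨m, rfl⟩ := G.modelToKac_surjective ρ q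
  induction m using TensorProduct.induction_on with
  | zero => simp only [map_zero]
  | add a b ha hb => simp only [map_add, ha, hb]
  | tmul t v =>
    rw [modelToKac_tmul, kac_inv, parity_extHom, ← modelToKac_tmul, ← modelToKac_tmul, kacProj,
      LinearMap.comp_apply, LinearMap.comp_apply, kacToModel_modelToKac, kacToModel_modelToKac,
      LinearMap.rTensor_tmul, LinearMap.rTensor_tmul, degProj_involute]
    refine Eq.trans ?_ (Superspace.inv_tensor_tmul G.topNeg.toSuperspace ρ.toSuperspace _ _).symm
    congr 1
    exact (Superspace.inv_pure (Module.finrank ℂ G.neg : ZMod 2) (degProj G.neg _ t)).symm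

/-- The link between the two halves of the argument: restricted to `Λ 𝔤₋₁`, the function attached to
an element of `K(V)` is given, up to sign, by the top-degree pairing. -/
theorem kacProj_envAct (t : ExteriorAlgebra ℂ G.neg) (m : G.Model V) :
    G.kacProj ρ ((G.kac ρ).envAct (G.extHom t) (G.modelToKac ρ m)) =
      topPairingTensor G.neg V m t := by
  induction m using TensorProduct.induction_on with
  | zero => simp only [map_zero, LinearMap.zero_apply]
  | add a b ha hb => simp only [map_add, LinearMap.add_apply, ha, hb]
  | tmul s v =>
    rw [modelToKac_tmul, kac_envAct, ← map_mul, ← modelToKac_tmul, kacProj, LinearMap.comp_apply,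
      kacToModel_modelToKac, topPairingTensor_apply]
    rfl

/-! ### Coinduced modules -/

/-- A subspace of `U(𝔤)` that contains the image of `Λ 𝔤₋₁` and is stable under left
multiplication by `𝔤_{≥0}` is equal to `U(𝔤)`. -/
theorem submodule_eq_top_of_extHom_mem {T : Submodule ℂ (Env 𝔤)} (h1 : ∀ t, G.extHom t ∈ T)
    (h2 : ∀ p ∈ G.nonneg.space, ∀ a ∈ T, Env.ι p * a ∈ T) : T = ⊤ := by
  -- The property of `a` that gets propagated is `Λ a ⊆ T`. For `y ∈ 𝔤₋₁` it passes to `y a` because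
  -- `Λ y ⊆ Λ`.
  have hneg : ∀ y : G.neg, ∀ a, (∀ t, G.extHom t * a ∈ T) →
      ∀ t, G.extHom t * (Env.ι y.1 * a) ∈ T := by
    intro y a ha t
    rw [← extHom_ι, ← mul_assoc, ← map_mul]
    exact ha _
  have heven : ∀ b : (evenPart 𝔤).space, ∀ t a, (∀ t, G.extHom t * a ∈ T) →
      G.extHom t * (Env.ι b.1 * a) ∈ T := by
    intro b t
    -- Move `b` to the left through `t`, from its last factor: `t y b a = t b (y a) - t [b, y] a`.
    -- The induction is over all `a`, because `a` becomes `y a`.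
    induction t using CliffordAlgebra.right_induction with
    | algebraMap r =>
      intro a ha
      rw [AlgHom.commutes, ← Algebra.smul_def]
      have := ha 1
      rw [map_one, one_mul] at this
      exact T.smul_mem _ (h2 _ (Submodule.mem_sup_left b.2) _ this)
    | add s t hs ht =>
      intro a ha
      rw [map_add, add_mul]
      exact T.add_mem (hs a ha) (ht a ha)
    | mul_ι y t ih =>
      intro a ha
      change G.extHom (t * ExteriorAlgebra.ι ℂ y) * _ ∈ T
      have h := Env.ι_br b.2 (G.isAbelianOdd_neg.le y.2)
      rw [zero_mul, sgn_zero, one_smul, eq_sub_iff_add_eq, ← eq_sub_iff_add_eq'] at h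
      have e : G.extHom (t * ExteriorAlgebra.ι ℂ y) * (Env.ι b.1 * a) =
          G.extHom t * (Env.ι b.1 * (Env.ι y.1 * a))
            - G.extHom t * (Env.ι (G.isAbelianOdd_neg.ad b y).1 * a) := by
        change _ = _ - G.extHom t * (Env.ι (br b.1 y.1) * a)
        rw [map_mul, extHom_ι, mul_assoc, ← mul_assoc (Env.ι y.1), h, sub_mul, mul_sub, mul_assoc]
      rw [e]
      exact T.sub_mem (ih _ (hneg y a ha)) (hneg _ a ha t)
  have hpos : ∀ x : G.pos, ∀ t a, (∀ t, G.extHom t * a ∈ T) →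
      G.extHom t * (Env.ι x.1 * a) ∈ T := by
    intro x t
    -- In the same way `t y x a = t [x, y] a - t x (y a)`, where the even element `[x, y]` is
    -- covered by `heven`.
    induction t using CliffordAlgebra.right_induction with
    | algebraMap r =>
      intro a ha
      rw [AlgHom.commutes, ← Algebra.smul_def]
      have := ha 1
      rw [map_one, one_mul] at this
      exact T.smul_mem _ (h2 _ (Submodule.mem_sup_right x.2) _ this)
    | add s t hs ht =>
      intro a ha
      rw [map_add, add_mul]
      exact T.add_mem (hs a ha) (ht a ha)
    | mul_ι y t ih =>
      intro a ha
      change G.extHom (t * ExteriorAlgebra.ι ℂ y) * _ ∈ T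
      have h := Env.ι_br (G.isAbelianOdd_pos.le x.2) (G.isAbelianOdd_neg.le y.2)
      rw [mul_one, sgn_one, neg_smul, one_smul, sub_neg_eq_add, ← sub_eq_iff_eq_add'] at h
      have e : G.extHom (t * ExteriorAlgebra.ι ℂ y) * (Env.ι x.1 * a) =
          G.extHom t * (Env.ι (G.pairing x y).1 * a)
            - G.extHom t * (Env.ι x.1 * (Env.ι y.1 * a)) := by
        change _ = G.extHom t * (Env.ι (br x.1 y.1) * a) - _
        rw [map_mul, extHom_ι, mul_assoc, ← mul_assoc (Env.ι y.1), ← h, sub_mul, mul_sub, mul_assoc]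
      rw [e]
      exact T.sub_mem (heven _ t a ha) (ih _ (hneg y a ha))
  have key : ∀ a t, G.extHom t * a ∈ T := by
    intro a
    induction a using Env.left_induction with
    | one => intro t; rw [mul_one]; exact h1 t
    | add a b ha hb => intro t; rw [mul_add]; exact T.add_mem (ha t) (hb t)
    | smul c a ha => intro t; rw [mul_smul_comm]; exact T.smul_mem c (ha t)
    | ι_mul x a ha =>
      intro t
      induction x using (grading : Superspace 𝔤).induction with
      | hadd x y hx hy => rw [map_add, add_mul, mul_add]; exact T.add_mem hx hy
      | h i x hx =>
        rcases zmod_two_cases i with rfl | rfl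
        · exact heven ⟨x, hx⟩ t a ha
        · obtain ⟨y, hy, z, hz, rfl⟩ := G.exists_add_of_odd hx
          rw [map_add, add_mul, mul_add]
          exact T.add_mem (hneg ⟨y, hy⟩ a ha t) (hpos ⟨z, hz⟩ t a ha)
  rw [eq_top_iff]
  intro a _
  simpa using key a 1

/-- The sign disappears: it could be nontrivial only for odd `p`, and these act by zero on the
inflated module. So the rule holds without homogeneity of `p` or `f`. -/
theorem coindSpace_apply_mul {f : Env 𝔤 →ₗ[ℂ] V}
    (hf : f ∈ Supermodule.coindSpace G.nonneg (G.extendNonneg ρ)) (p : G.nonneg.space)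
    (a : Env 𝔤) : f (Env.ι p.1 * a) = ρ.act (projEven 𝔤 p.1) (f a) := by
  have key : ∀ i, ∀ f ∈ Supermodule.coindHom G.nonneg (G.extendNonneg ρ) i,
      f (Env.ι p.1 * a) = ρ.act (projEven 𝔤 p.1) (f a) := by
    intro i f hf
    induction p using (grading : Superspace G.nonneg.space).induction with
    | hadd p q hp hq =>
      rw [Submodule.coe_add, map_add, map_add, map_add, add_mul, map_add, hp, hq]; rfl
    | h j p hp =>
      rw [hf.2 j p hp, extendNonneg_act]
      rcases zmod_two_cases j with rfl | rfl
      · rw [zero_mul, sgn_zero, one_smul]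
      · have h0 : projEven 𝔤 p.1 = 0 := projEven_odd hp
        rw [h0, map_zero, LinearMap.zero_apply, smul_zero]
  obtain ⟨f0, h0, f1, h1, rfl⟩ := Submodule.mem_sup.1 hf
  rw [LinearMap.add_apply, LinearMap.add_apply, key 0 f0 h0, key 1 f1 h1, map_add]

/-- The kernel of `f` is stable under left multiplication by `𝔤_{≥0}`, so if it contains `Λ 𝔤₋₁` it
is all of `U(𝔤)`. -/
theorem coindSpace_eq_zero {f : Env 𝔤 →ₗ[ℂ] V}
    (hf : f ∈ Supermodule.coindSpace G.nonneg (G.extendNonneg ρ))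
    (h : ∀ t, f (G.extHom t) = 0) : f = 0 := by
  have : LinearMap.ker f = ⊤ := G.submodule_eq_top_of_extHom_mem h fun p hp a ha => by
    rw [LinearMap.mem_ker] at ha ⊢
    rw [G.coindSpace_apply_mul ρ hf ⟨p, hp⟩, ha, map_zero]
  exact LinearMap.ker_eq_top.1 this

/-- If `Λ^max(𝔤₋₁) ⊗ σ ≅ ρ`, then `K(σ) ≅ Coind_{𝔤_{≥0}}^𝔤 ρ`. -/
theorem kac_iso_coindNonneg [FiniteDimensional ℂ G.neg] {X : Type w} [AddCommGroup X] [Module ℂ X]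
    (σ : Supermodule (evenPart 𝔤).space X) (h : (G.topNeg.tensor σ).Iso ρ) :
    (G.kac σ).Iso (G.coindNonneg ρ) := by
  obtain ⟨e, he1, he2⟩ := h
  have hbij : Function.Bijective fun (m : G.Model X) =>
      e.toLinearMap ∘ₗ topPairingTensor G.neg X m :=
    (LinearEquiv.congrRight (M := ExteriorAlgebra ℂ G.neg) e).bijective.comp
      topPairingTensor_bijective
  have heven : ∀ i, ∀ q ∈ (G.kac σ).part i,
      (e.toLinearMap ∘ₗ G.kacProj σ) q ∈ (G.extendNonneg ρ).part i :=
    fun i q hq => (he1 i _).1 (G.kacProj_even σ i q hq)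
  have hact : ∀ (p : G.nonneg.space) q, (e.toLinearMap ∘ₗ G.kacProj σ) ((G.kac σ).act p.1 q) =
      (G.extendNonneg ρ).act p ((e.toLinearMap ∘ₗ G.kacProj σ) q) := by
    intro p q
    rw [LinearMap.comp_apply, kacProj_act, extendNonneg_act]
    exact he2 _ _
  refine Supermodule.iso_coind heven hact (fun q hq => ?_) fun f hf => ?_
  · obtain ⟨m, rfl⟩ := G.modelToKac_surjective σ q
    have : m = 0 := by
      apply hbij.1
      refine LinearMap.ext fun t => ?_
      have := hq (G.extHom t)
      rw [LinearMap.comp_apply, kacProj_envAct] at this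
      simpa using this
    rw [this, map_zero]
  · let g : Env 𝔤 →ₗ[ℂ] V := f ∘ₗ (Env.superspace 𝔤).proj 0 - ρ.inv ∘ₗ f ∘ₗ (Env.superspace 𝔤).proj 1
    obtain ⟨m, hm⟩ := hbij.2 (g ∘ₗ G.extHom.toLinearMap)
    refine ⟨G.modelToKac σ m, ?_⟩
    rw [← sub_eq_zero]
    -- Both functions are coinduced, so it is enough that they agree on `Λ 𝔤₋₁`.
    refine G.coindSpace_eq_zero ρ
      (Submodule.sub_mem _ (Supermodule.coindFun_mem heven hact _) hf) fun t => ?_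
    rw [LinearMap.sub_apply, sub_eq_zero]
    have key : Supermodule.coindFun (G.kac σ) (G.extendNonneg ρ) (e.toLinearMap ∘ₗ G.kacProj σ)
        (G.modelToKac σ m) ∘ₗ G.extHom.toLinearMap = f ∘ₗ G.extHom.toLinearMap := by
      apply linearMap_ext_ιMulti
      intro n w
      have hm' := LinearMap.congr_fun hm (ιMulti ℂ n w)
      simp only [LinearMap.comp_apply, AlgHom.toLinearMap_apply] at hm'
      have hu := G.extHom_ιMulti_mem n w
      simp only [LinearMap.comp_apply, AlgHom.toLinearMap_apply]
      generalize (n : ZMod 2) = i at hu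
      have h1 := (Env.superspace 𝔤).proj_of_mem hu
      have h2 := (Env.superspace 𝔤).proj_add_one_of_mem hu
      rcases zmod_two_cases i with rfl | rfl
      · rw [zero_add] at h2
        rw [Supermodule.coindFun_even _ _ _ hu, LinearMap.comp_apply, kacProj_envAct, hm']
        simp [g, h1, h2]
      · rw [show (1 : ZMod 2) + 1 = 0 by decide] at h2
        rw [Supermodule.coindFun_odd _ _ _ hu, LinearMap.comp_apply, kacProj_envAct, hm']
        have : (G.extendNonneg ρ).inv = ρ.inv := rfl
        simp [g, h1, h2, this, Superspace.inv_inv]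
    exact LinearMap.congr_fun key t

end Coind

end CompatibleGrading

/-! ### Top exterior powers -/

section TopExterior

variable {W : Type v} [AddCommGroup W] [Module ℂ W] [FiniteDimensional ℂ W]

/-- An endomorphism acts on the top exterior power by its trace. -/
theorem extPowerDeriv_finrank (A : Module.End ℂ W) (ξ : ⋀[ℂ]^(Module.finrank ℂ W) W) :
    extPowerDeriv (Module.finrank ℂ W) A ξ = LinearMap.trace ℂ W A • ξ := by
  let b := Module.finBasis ℂ W
  have hspan := exteriorPower.ιMulti_span_of_span ℂ (Module.finrank ℂ W) W b.span_eq
  have hξ : ξ ∈ Submodule.span ℂ (exteriorPower.ιMulti ℂ (Module.finrank ℂ W) ''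
    {a | Set.range a ⊆ Set.range b}) := hspan ▸ Submodule.mem_top
  induction hξ using Submodule.span_induction with
  | zero => simp only [map_zero, smul_zero]
  | add x y _ _ hx hy => rw [map_add, hx, hy, smul_add]
  | smul c x _ hx => rw [map_smul, hx, smul_comm]
  | mem x h =>
    obtain ⟨w, hw, rfl⟩ := h
    -- A family of `d` vectors of the basis is either a reordering of the basis or has a repeated
    -- entry, in which case its exterior product vanishes.
    by_cases hinj : Function.Injective w
    · have hbas : ∀ i, ∃ j, b j = w i := fun i => hw ⟨i, rfl⟩
      choose σ hσ using hbas
      have hσinj : Function.Injective σ := fun i j hij => hinj (by rw [← hσ, ← hσ, hij])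
      have hbij : Function.Bijective σ := Finite.injective_iff_bijective.1 hσinj
      let c := b.reindex (Equiv.ofBijective σ hbij).symm
      have hc : w = c := by
        funext i
        simp [c, hσ]
      rw [extPowerDeriv_ιMulti, LinearMap.trace_eq_matrix_trace ℂ c, Matrix.trace, Finset.sum_smul]
      refine Finset.sum_congr rfl fun i _ => ?_
      rw [Matrix.diag_apply, LinearMap.toMatrix_apply, hc]
      -- Expand `A cᵢ` in the basis: a term in `cⱼ` with `j ≠ i` repeats a vector of the product, so
      -- only the diagonal coefficient survives.
      nth_rewrite 1 [← c.sum_repr (A (c i))]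
      rw [AlternatingMap.map_update_sum, Finset.sum_eq_single i]
      · rw [AlternatingMap.map_update_smul, Function.update_eq_self]
      · intro j _ hj
        rw [AlternatingMap.map_update_smul]
        rw [(exteriorPower.ιMulti ℂ _).map_eq_zero_of_eq _ (i := i) (j := j) (by simp [hj]) hj.symm,
          smul_zero]
      · simp
    · rw [Function.not_injective_iff] at hinj
      obtain ⟨i, j, hij, hne⟩ := hinj
      rw [(exteriorPower.ιMulti ℂ _).map_eq_zero_of_eq w hij hne, map_zero, smul_zero]

end TopExterior

/-! ### Cancellation of the top exterior powers of `𝔤₋₁` and its dual -/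

namespace CompatibleGrading

variable {𝔤 : Type u} [AddCommGroup 𝔤] [Module ℂ 𝔤] [LieSuperalgebra 𝔤] (G : CompatibleGrading 𝔤)
  {V : Type w} [AddCommGroup V] [Module ℂ V] (ρ : Supermodule (evenPart 𝔤).space V)

theorem topNeg_act [FiniteDimensional ℂ G.neg] (a : (evenPart 𝔤).space)
    (ξ : ⋀[ℂ]^(Module.finrank ℂ G.neg) G.neg) :
    G.topNeg.act a ξ = LinearMap.trace ℂ _ (G.isAbelianOdd_neg.ad a) • ξ :=
  extPowerDeriv_finrank _ ξ

/-- The dual action is minus the transpose, and transposition preserves the trace. -/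
theorem topNegDual_act [FiniteDimensional ℂ G.neg] (a : (evenPart 𝔤).space)
    (ξ : ⋀[ℂ]^(Module.finrank ℂ (Module.Dual ℂ G.neg)) (Module.Dual ℂ G.neg)) :
    G.topNegDual.act a ξ = -LinearMap.trace ℂ _ (G.isAbelianOdd_neg.ad a) • ξ := by
  refine (extPowerDeriv_finrank (G.isAbelianOdd_neg.coad a) ξ).trans ?_
  congr 1
  change LinearMap.trace ℂ _ (-Module.Dual.transpose (R := ℂ) (G.isAbelianOdd_neg.ad a)) = _
  rw [map_neg, LinearMap.trace_transpose']

/-- If `L` and `L'` are one-dimensional of the same parity, on which `𝔤₀` acts by opposite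
characters, then `L ⊗ (L' ⊗ V) ≅ V`. -/
theorem _root_.Supermodule.tensor_tensor_iso {L : Type v} [AddCommGroup L] [Module ℂ L]
    {L' : Type v} [AddCommGroup L'] [Module ℂ L'] (l : Supermodule (evenPart 𝔤).space L)
    (l' : Supermodule (evenPart 𝔤).space L') (e : L ≃ₗ[ℂ] ℂ) (e' : L' ≃ₗ[ℂ] ℂ)
    (c : (evenPart 𝔤).space → ℂ) (hl : ∀ a ξ, l.act a ξ = c a • ξ)
    (hl' : ∀ a ξ, l'.act a ξ = -c a • ξ) (d : ZMod 2) (hd : ∀ ξ, l.inv ξ = sgn d • ξ)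
    (hd' : ∀ ξ, l'.inv ξ = sgn d • ξ) : (l.tensor (l'.tensor ρ)).Iso ρ := by
  let F := (TensorProduct.congr e ((TensorProduct.congr e' (LinearEquiv.refl ℂ V)).trans
    (TensorProduct.lid ℂ V))).trans (TensorProduct.lid ℂ V)
  have hF : ∀ ξ η v, F (ξ ⊗ₜ (η ⊗ₜ v)) = (e ξ * e' η) • v := fun ξ η v => by
    simp [F, mul_smul, smul_comm (e ξ)]
  refine Supermodule.Iso.of_bijective F.toLinearMap F.bijective ?_ ?_
  · apply Superspace.even_of_map_inv
    intro m
    induction m using TensorProduct.induction_on with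
    | zero => simp only [map_zero]
    | add a b ha hb => simp only [map_add, ha, hb]
    | tmul ξ m =>
      induction m using TensorProduct.induction_on with
      | zero => simp only [map_zero, TensorProduct.tmul_zero]
      | add a b ha hb => simp only [map_add, TensorProduct.tmul_add, ha, hb]
      | tmul η v =>
        have h1 : (l.tensor (l'.tensor ρ)).inv (ξ ⊗ₜ (η ⊗ₜ v)) =
            (sgn d • ξ) ⊗ₜ ((sgn d • η) ⊗ₜ ρ.inv v) := by
          rw [← hd, ← hd']
          refine (Superspace.inv_tensor_tmul l.toSuperspace
            (l'.tensor ρ).toSuperspace _ _).trans ?_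
          congr 1
          exact Superspace.inv_tensor_tmul l'.toSuperspace ρ.toSuperspace _ _
        rw [h1, LinearEquiv.coe_coe, hF, hF, map_smul, map_smul, map_smul, smul_eq_mul, smul_eq_mul,
          mul_mul_mul_comm, sgn_mul_self, one_mul]
  · intro a m
    induction m using TensorProduct.induction_on with
    | zero => simp only [map_zero]
    | add a b ha hb => simp only [map_add, ha, hb]
    | tmul ξ m =>
      induction m using TensorProduct.induction_on with
      | zero => simp only [map_zero, TensorProduct.tmul_zero]
      | add a b ha hb => simp only [map_add, TensorProduct.tmul_add, ha, hb]
      | tmul η v =>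
        rw [tensor_act_tmul, tensor_act_tmul, hl, hl', LinearEquiv.coe_coe, TensorProduct.tmul_add,
          map_add, map_add, hF, hF, hF, hF, map_smul e, map_smul e', map_smul, smul_eq_mul,
          smul_eq_mul, ← add_assoc, ← add_smul]
        rw [show ∀ c x y : ℂ, c * x * y + x * (-c * y) = 0 by intros; ring, zero_smul, zero_add]

/-- `Λ^max(𝔤₋₁) ⊗ (Λ^max(𝔤₋₁^*) ⊗ V) ≅ V`. -/
theorem topNeg_tensor_topNegDual_iso [FiniteDimensional ℂ G.neg] :
    (G.topNeg.tensor (G.topNegDual.tensor ρ)).Iso ρ := by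
  refine Supermodule.tensor_tensor_iso ρ G.topNeg G.topNegDual
    (LinearEquiv.ofFinrankEq (R := ℂ) _ ℂ
      (by rw [ExteriorAlgebra.finrank_top, Module.finrank_self]))
    (LinearEquiv.ofFinrankEq (R := ℂ) _ ℂ
      (by rw [ExteriorAlgebra.finrank_top, Module.finrank_self]))
    _ G.topNeg_act G.topNegDual_act (Module.finrank ℂ G.neg : ZMod 2)
    (fun ξ => Superspace.inv_pure _ ξ) (fun η => ?_)
  have h := Superspace.inv_pure (Module.finrank ℂ (Module.Dual ℂ G.neg) : ZMod 2) η
  -- The space and its dual have the same dimension, so the two lines have the same parity and their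
  -- tensor product is even.
  have hd : sgn (Module.finrank ℂ (Module.Dual ℂ G.neg) : ZMod 2) =
      sgn (Module.finrank ℂ G.neg : ZMod 2) := by
    rw [Subspace.dual_finrank_eq]
  exact h.trans (congrArg (· • η) hd)

theorem coindNonneg_topNeg_iso [FiniteDimensional ℂ G.neg] :
    (G.coindNonneg (G.topNeg.tensor ρ)).Iso (G.kac ρ) :=
  (G.kac_iso_coindNonneg _ ρ (.refl _)).symm

/-- The general criterion with `σ = Λ^max(𝔤₋₁^*) ⊗ V`, for which `Λ^max(𝔤₋₁) ⊗ σ` is again `V`. -/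
theorem coindNonneg_iso_kac_topNegDual [FiniteDimensional ℂ G.neg] :
    (G.coindNonneg ρ).Iso (G.kac (G.topNegDual.tensor ρ)) :=
  (G.kac_iso_coindNonneg _ _ (G.topNeg_tensor_topNegDual_iso ρ)).symm

end CompatibleGrading

end

theorem theorem3p5 {𝔤 : Type*} [AddCommGroup 𝔤] [Module ℂ 𝔤] [LieSuperalgebra 𝔤]
    (G : CompatibleGrading 𝔤)
    (hfin : FiniteDimensional ℂ ((LieSuperalgebra.grading : Superspace 𝔤).part 1))
    {V : Type*} [AddCommGroup V] [Module ℂ V]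
    (ρ : Supermodule (evenPart 𝔤).space V) (hρ : ρ.IsSimple) :
    (G.coindNonneg (G.topNeg.tensor ρ)).IsoUpToParity (G.kac ρ) ∧
    (G.coindNonneg ρ).IsoUpToParity (G.kac (G.topNegDual.tensor ρ)) ∧
    (G.coindNonpos (G.topPos.tensor ρ)).IsoUpToParity (G.oppKac ρ) ∧
    (G.coindNonpos ρ).IsoUpToParity (G.oppKac (G.topPosDual.tensor ρ)) := by
  have hneg : FiniteDimensional ℂ G.neg :=
    Submodule.finiteDimensional_of_le G.isAbelianOdd_neg.le
  have hpos : FiniteDimensional ℂ G.swap.neg :=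
    Submodule.finiteDimensional_of_le G.isAbelianOdd_pos.le
  -- For the exchanged grading, the modules attached to `𝔤_{≥0}` are by definition those attached to
  -- `𝔤_{≤0}` for `G`.
  exact ⟨.inl (G.coindNonneg_topNeg_iso ρ), .inl (G.coindNonneg_iso_kac_topNegDual ρ),
    .inl (G.swap.coindNonneg_topNeg_iso ρ), .inl (G.swap.coindNonneg_iso_kac_topNegDual ρ)⟩
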